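/- Let $s_0=\lambda, s_1=0, s_2=1, s_3=00, s_4=01,\ldots$ be the standard enumeration of $\{0,1\}^*$, and identify a language $L\subseteq\{0,1\}^*$ with its characteristic sequence $\chi_L(s_0)\chi_L(s_1)\chi_L(s_2)\cdots\in\{0,1\}^{\infty}$. A *constructor* is a total function $\delta:\{0,1\}^*\to\{0,1\}^*$ such that $x$ is a proper prefix of $\delta(x)$ for every $x$. Its *result* $R(\delta)\in\{0,1\}^{\infty}$ is the unique infinite sequence that extends $\delta^{(n)}(\lambda)$ for all $n\ge 0$. For a class $\Delta$ of functions $\{0,1\}^*\to\{0,1\}^*$, the *result class* is $R(\Delta)=\{R(\delta) : \delta\in\Delta \text{ is a constructor}\}$. A *single-valued $\mathsf{FS}_2^{\mathsf P}$ algorithm* is given by a polynomial $\ell$ and a polynomial-time computable $V_A(x,\pi_1,\pi_2)\in\{0,1\}^*$. It *outputs* $y$ on input $x$ if there is $\pi_1\in\{0,1\}^{\ell(|x|)}$ such that $V_A(x,\pi_1,\pi_2)=y$ for every $\pi_2\in\{0,1\}^{\ell(|x|)}$, and there is $\pi_2\in\{0,1\}^{\ell(|x|)}$ such that $V_A(x,\pi_1,\pi_2)=y$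 for every $\pi_1\in\{0,1\}^{\ell(|x|)}$. Let $\mathsf{FS}_2^{\mathsf P}$ be the class of total functions $f:\{0,1\}^*\to\{0,1\}^*$ for which some single-valued $\mathsf{FS}_2^{\mathsf P}$ algorithm outputs $f(x)$ on every input $x$. For $T:\mathbb N\to\mathbb N$, a language $L$ is in $\mathsf S_2\mathsf{TIME}[T(n)]$ if there is an $O(T(n))$-time verifier $V(x,\pi_1,\pi_2)\in\{0,1\}$, taking $x\in\{0,1\}^n$ and $\pi_1,\pi_2\in\{0,1\}^{T(n)}$, such that for every $x$ both $(\exists\pi_1)(\forall\pi_2)\,V(x,\pi_1,\pi_2)=\chi_L(x)$ and $(\exists\pi_2)(\forall\pi_1)\,V(x,\pi_1,\pi_2)=\chi_L(x)$ hold. Let $\mathsf S_2^{\mathsf E}=\bigcup_{c\ge 1}\mathsf S_2\mathsf{TIME}[2^{cn}]$. (Computations are by multi-stack, equivalently multi-tape, Turing machines.) **Lemma.** $R(\mathsf{FS}_2^{\mathsf P})=\mathsf S_2^{\mathsf E}$. -/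

import Mathlib

namespace SymAlt

/-! ### Cantor space and the standard enumeration of binary strings -/

/-- The standard enumeration `λ, 0, 1, 00, 01, 10, 11, 000, …` of the binary strings:
`stdEnum n` is the binary expansion of `n + 1`, most significant bit first, without its
leading `1`. -/
def stdEnum (n : ℕ) : List Bool :=
  (Nat.bits (n + 1)).dropLast.reverse

theorem exists_bits_eq (l : List Bool) : ∃ n, Nat.bits (n + 1) = l ++ [true] := by
  induction l with
  | nil => exact ⟨0, by simp⟩
  | cons b l ih =>
    obtain ⟨n, hn⟩ := ih
    refine ⟨Nat.bit b (n + 1) - 1, ?_⟩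
    have h : Nat.bit b (n + 1) - 1 + 1 = Nat.bit b (n + 1) := by
      have : Nat.bit b (n + 1) ≠ 0 := by cases b <;> simp [Nat.bit_val]
      omega
    rw [h, Nat.bits_append_bit _ _ (fun h0 => absurd h0 (Nat.succ_ne_zero n)), hn,
      List.cons_append]

theorem bits_injective : Function.Injective Nat.bits := by
  have key : ∀ n : ℕ, (Nat.bits n).foldr Nat.bit 0 = n := by
    intro n
    induction n using Nat.binaryRec' with
    | zero => simp
    | bit b n h ih => rw [Nat.bits_append_bit _ _ h, List.foldr_cons, ih]
  intro m n h
  rw [← key m, ← key n, h]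

theorem bits_succ_eq (n : ℕ) : Nat.bits (n + 1) = (Nat.bits (n + 1)).dropLast ++ [true] := by
  have key : ∀ m : ℕ, m ≠ 0 → ∃ l, Nat.bits m = l ++ [true] := by
    intro m
    induction m using Nat.binaryRec' with
    | zero => simp
    | bit b k h ih =>
      intro hm
      rw [Nat.bits_append_bit _ _ h]
      rcases eq_or_ne k 0 with rfl | hk
      · exact ⟨[], by simp [h rfl]⟩
      · obtain ⟨l, hl⟩ := ih hk
        exact ⟨b :: l, by rw [hl, List.cons_append]⟩
  obtain ⟨l, hl⟩ := key (n + 1) (Nat.succ_ne_zero n)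
  rw [hl, List.dropLast_concat]

/-- The standard enumeration lists every string exactly once. -/
theorem stdEnum_bijective : Function.Bijective stdEnum := by
  constructor
  · intro m n h
    have h' : (Nat.bits (m + 1)).dropLast = (Nat.bits (n + 1)).dropLast :=
      List.reverse_injective h
    have := bits_injective ((bits_succ_eq m).trans ((congrArg (· ++ [true]) h').trans
      (bits_succ_eq n).symm))
    omega
  · intro w
    obtain ⟨n, hn⟩ := exists_bits_eq w.reverse
    exact ⟨n, by simp [stdEnum, hn]⟩

/-- The characteristic function of a language. -/
noncomputable def chi (L : Language Bool) (x : List Bool) : Bool :=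
  open Classical in decide (x ∈ L)

/-- The characteristic sequence of a language, a point of Cantor space `ℕ → Bool`. -/
noncomputable def charSeq (L : Language Bool) : ℕ → Bool :=
  fun n => chi L (stdEnum n)

/-! ### Constructors and result classes -/

/-- `δ` is a constructor: every string is a proper prefix of its image. -/
def IsConstructor (δ : List Bool → List Bool) : Prop :=
  ∀ x, x <+: δ x ∧ x ≠ δ x

/-- The infinite sequence `S` extends the finite string `w`. -/
def Extends (S : ℕ → Bool) (w : List Bool) : Prop :=
  ∀ (i : ℕ) (h : i < w.length), S i = w[i]

/-- `S` is the result of `δ`: it extends every iterate of `δ` on the empty string. -/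
def IsResult (δ : List Bool → List Bool) (S : ℕ → Bool) : Prop :=
  ∀ n : ℕ, Extends S (δ^[n] [])

/-- The result class of a class `Δ` of string functions: the set of all results of the
constructors in `Δ`. -/
def resultClass (Δ : Set (List Bool → List Bool)) : Set (ℕ → Bool) :=
  {S | ∃ δ ∈ Δ, IsConstructor δ ∧ IsResult δ S}

theorem IsConstructor.le_length_iterate {δ : List Bool → List Bool} (hδ : IsConstructor δ)
    (n : ℕ) : n ≤ (δ^[n] []).length := by
  induction n with
  | zero => simp
  | succ k ih =>
    rw [Function.iterate_succ_apply']
    obtain ⟨hp, hne⟩ := hδ (δ^[k] [])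
    have h1 := hp.length_le
    have h2 : (δ^[k] []).length ≠ (δ (δ^[k] [])).length := fun h => hne (hp.eq_of_length h)
    omega

theorem IsConstructor.iterate_prefix {δ : List Bool → List Bool} (hδ : IsConstructor δ)
    {m n : ℕ} (h : m ≤ n) : δ^[m] [] <+: δ^[n] [] := by
  induction n, h using Nat.le_induction with
  | base => exact List.prefix_rfl
  | succ k _ ih =>
    rw [Function.iterate_succ_apply']
    exact ih.trans (hδ _).1

/-- A constructor has exactly one result. -/
theorem IsConstructor.existsUnique_isResult {δ : List Bool → List Bool}
    (hδ : IsConstructor δ) : ∃! S, IsResult δ S := by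
  have hl : ∀ i, i < (δ^[i + 1] []).length := fun i => hδ.le_length_iterate (i + 1)
  refine ⟨fun i => (δ^[i + 1] [])[i]'(hl i), ?_, ?_⟩
  · intro n i hi
    rcases le_total (i + 1) n with h | h
    · exact (hδ.iterate_prefix h).getElem (hl i)
    · exact ((hδ.iterate_prefix h).getElem hi).symm
  · intro S hS
    funext i
    exact hS (i + 1) i (hl i)

/-! ### Verifiers, on multi-stack Turing machines -/

/-- The encoding of a verifier's input `(x, π₁, π₂)` as the word `x # π₁ # π₂`; the separator
`#` is `none`. -/
def encTriple (p : List Bool × List Bool × List Bool) : List (Option Bool) :=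
  p.1.map some ++ none :: (p.2.1.map some ++ none :: p.2.2.map some)

/-- The language class `S₂TIME[T(n)]`: the verifier `V` is run on `x` of any length `n` and on
proofs `π₁, π₂` of length `T n`, and halts with its output bit after `O(T n)` steps. -/
def S2TIME (T : ℕ → ℕ) : Set (Language Bool) :=
  {L | ∃ V : List Bool → List Bool → List Bool → Bool,
    (∃ (M : Turing.TM2ComputableAux (Option Bool) Bool) (t : ℕ → ℕ),
      Asymptotics.IsBigO Filter.atTop (fun n => (t n : ℝ)) (fun n => (T n : ℝ)) ∧
      ∀ x π₁ π₂ : List Bool, π₁.length = T x.length → π₂.length = T x.length →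
        Nonempty (Turing.TM2OutputsInTime M.tm
          ((encTriple (x, π₁, π₂)).map M.inputAlphabet.symm)
          (some ([V x π₁ π₂].map M.outputAlphabet.symm))
          (t x.length))) ∧
    ∀ x : List Bool,
      (∃ π₁ : List Bool, π₁.length = T x.length ∧
        ∀ π₂ : List Bool, π₂.length = T x.length → V x π₁ π₂ = chi L x) ∧
      (∃ π₂ : List Bool, π₂.length = T x.length ∧
        ∀ π₁ : List Bool, π₁.length = T x.length → V x π₁ π₂ = chi L x)}

/-- The class `S₂^E`, the union of `S₂TIME[2^(c n)]` over `c ≥ 1`. -/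
def S2E : Set (Language Bool) :=
  ⋃ c ∈ Set.Ici (1 : ℕ), S2TIME fun n => 2 ^ (c * n)

/-- A single-valued `FS₂^P` algorithm: a polynomial `ℓ` and a polynomial-time verifier. -/
structure FS2PAlgorithm where
  /-- the proof length -/
  ℓ : Polynomial ℕ
  /-- the function that the verifier computes -/
  V : List Bool → List Bool → List Bool → List Bool
  /-- the verifier runs in time polynomial in the length of its input -/
  polyTime : Nonempty (Turing.TM2ComputableInPolyTime encTriple (id : List Bool → List Bool)
    fun p => V p.1 p.2.1 p.2.2)

/-- The algorithm `A` outputs `y` on input `x`. -/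
def FS2PAlgorithm.Outputs (A : FS2PAlgorithm) (x y : List Bool) : Prop :=
  (∃ π₁ : List Bool, π₁.length = A.ℓ.eval x.length ∧
    ∀ π₂ : List Bool, π₂.length = A.ℓ.eval x.length → A.V x π₁ π₂ = y) ∧
  (∃ π₂ : List Bool, π₂.length = A.ℓ.eval x.length ∧
    ∀ π₁ : List Bool, π₁.length = A.ℓ.eval x.length → A.V x π₁ π₂ = y)

/-- The class of total functions computed by single-valued `FS₂^P` algorithms. -/
def FS2P : Set (List Bool → List Bool) :=
  {f | ∃ A : FS2PAlgorithm, ∀ x, A.Outputs x (f x)}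

end SymAlt

/-! The lengths match because `s_n` has about `log n` bits: `2 ^ |s_n| ≤ n + 1`
(`two_pow_length_stdEnum_le`), so time `2 ^ (c * |s_n|)` is polynomial in `n`; conversely a
polynomial in `n` is `2 ^ O(|s_n|)` for nonempty `s_n` (`exists_eval_two_pow_le`).

For `L` in `S2E`, the constructor `y ↦ y ++ [χ_L(s_|y|)]` has result `charSeq L`. Its verifier runs
the one of `L` on `s_|y|`, whose proofs have length at most `(|y| + 1) ^ c`, and appends the answer
(`append_chi_mem_FS2P`).

For a constructor `δ` with algorithm `A`, bit `N` of the result is read off `δ^[N + 1] []`. The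
iterates may grow too fast, so each is cut to `N + 1` bits; by the prefix property this does not
affect these bits (`IsConstructor.iterate_take`). Each application of `δ` after the first is
evaluated by `A`, and a proof for the language is the concatenation of the proofs for these rounds.
A prover with a winning proof in every round forces each value, whatever the opponent does. Hence
the current string, and with it the place where the next proof begins, is known in advance
(`exists_honest`). The other prover is treated by symmetry (`verifyStep_swap`).

The rest is machine construction. A small while language over stacks is compiled to `TM2` machines
(`Exec.iterate_step`), and can call a given machine with constant slowdown (`exists_sim_effect`).
Numbers are kept in unary, since all of them may be as large as the time bounds allow. The two
programs are `appendBit` and `verifier`. -/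

namespace SymAlt

open Turing Function

/-! ### While programs over finitely many stacks -/

/-- While programs that act on a finite control state in `σ` and on stacks with alphabets `Γ k`. -/
inductive Prog {K : Type} (Γ : K → Type) (σ : Type) : Type 1
  | push (k : K) (f : σ → Γ k) : Prog Γ σ
  | peek (k : K) (f : σ → Option (Γ k) → σ) : Prog Γ σ
  | pop (k : K) (f : σ → Option (Γ k) → σ) : Prog Γ σ
  | load (f : σ → σ) : Prog Γ σ
  | seq (p q : Prog Γ σ) : Prog Γ σ
  | switch (ι : Type) (fin : Fintype ι) (f : σ → ι) (p : ι → Prog Γ σ) : Prog Γ σ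
  | loop (c : σ → Bool) (p : Prog Γ σ) : Prog Γ σ

/-- Sequential composition of programs. -/
infixr:67 ";;" => Prog.seq

namespace Prog

variable {K : Type} {Γ : K → Type} {σ : Type}

/-- The control points of a program. -/
def Lbl : Prog Γ σ → Type
  | push _ _ | peek _ _ | pop _ _ | load _ => Unit
  | seq p q => p.Lbl ⊕ q.Lbl
  | switch ι _ _ p => Option (Σ i : ι, (p i).Lbl)
  | loop _ p => Option p.Lbl

/-- A program has finitely many control points. -/
@[reducible] noncomputable def fintypeLbl : (p : Prog Γ σ) → Fintype p.Lbl
  | push _ _ | peek _ _ | pop _ _ | load _ => inferInstanceAs (Fintype Unit)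
  | seq p q =>
    letI := p.fintypeLbl
    letI := q.fintypeLbl
    inferInstanceAs (Fintype (p.Lbl ⊕ q.Lbl))
  | switch ι _ _ p =>
    letI := fun i => (p i).fintypeLbl
    inferInstanceAs (Fintype (Option (Σ i : ι, (p i).Lbl)))
  | loop _ p =>
    letI := p.fintypeLbl
    inferInstanceAs (Fintype (Option p.Lbl))

/-- The control point at which a program starts. -/
def entry : (p : Prog Γ σ) → p.Lbl
  | push _ _ | peek _ _ | pop _ _ | load _ => ()
  | seq p _ => Sum.inl p.entry
  | switch _ _ _ _ | loop _ _ => none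

/-- The statements of a multi-stack Turing machine that executes the program, where `emb` places
the control points among the labels of the machine, and `next` is the label to go to at the end. -/
def code : (p : Prog Γ σ) → {Λ : Type} → (emb : p.Lbl → Λ) → (next : Λ) → p.Lbl → TM2.Stmt Γ Λ σ
  | push k f, _, _, next, _ => .push k f (.goto fun _ => next)
  | peek k f, _, _, next, _ => .peek k f (.goto fun _ => next)
  | pop k f, _, _, next, _ => .pop k f (.goto fun _ => next)
  | load f, _, _, next, _ => .load f (.goto fun _ => next)
  | seq p q, _, emb, next, l =>
    Sum.elim (p.code (fun a => emb (Sum.inl a)) (emb (Sum.inr q.entry)))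
      (q.code (fun a => emb (Sum.inr a)) next) l
  | switch _ _ f p, _, emb, next, l =>
    Option.elim l (.goto fun v => emb (some ⟨f v, (p (f v)).entry⟩))
      fun a => (p a.1).code (fun b => emb (some ⟨a.1, b⟩)) next a.2
  | loop c p, _, emb, next, l =>
    Option.elim l (.branch c (.goto fun _ => emb (some p.entry)) (.goto fun _ => next))
      fun a => p.code (fun b => emb (some b)) (emb none) a

/-- Memory contents: the control state and the stacks. -/
abbrev Mem (Γ : K → Type) (σ : Type) : Type := σ × (∀ k, List (Γ k))

variable [DecidableEq K]

/-- `Exec p t m m'`: the program `p`, started with memory `m`, ends with memory `m'` after exactly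
`t` steps. -/
inductive Exec : Prog Γ σ → ℕ → Mem Γ σ → Mem Γ σ → Prop
  | push (k f v S) : Exec (push k f) 1 (v, S) (v, update S k (f v :: S k))
  | peek (k f v S) : Exec (peek k f) 1 (v, S) (f v (S k).head?, S)
  | pop (k f v S) : Exec (pop k f) 1 (v, S) (f v (S k).head?, update S k (S k).tail)
  | load (f v S) : Exec (load f) 1 (v, S) (f v, S)
  | seq {p q s t m₁ m₂ m₃} : Exec p s m₁ m₂ → Exec q t m₂ m₃ → Exec (seq p q) (s + t) m₁ m₃
  | switch {ι fin f p t m m'} : Exec (p (f m.1)) t m m' → Exec (switch ι fin f p) (1 + t) m m'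
  | loop_exit {c p m} : c m.1 = false → Exec (loop c p) 1 m m
  | loop_step {c p s t m₁ m₂ m₃} : c m₁.1 = true → Exec p s m₁ m₂ → Exec (loop c p) t m₂ m₃ →
      Exec (loop c p) (1 + s + t) m₁ m₃

/-- A machine whose labels include the control points of a program executes the program. -/
theorem Exec.iterate_step {Λ : Type} {M : Λ → TM2.Stmt Γ Λ σ} {p : Prog Γ σ} {t : ℕ}
    {m m' : Mem Γ σ} (h : Exec p t m m') :
    ∀ (emb : p.Lbl → Λ) (next : Λ), (∀ l, M (emb l) = p.code emb next l) →
      (flip bind (TM2.step M))^[t] (some ⟨some (emb p.entry), m.1, m.2⟩) =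
        some ⟨some next, m'.1, m'.2⟩ := by
  induction h with
  | push k f v S | peek k f v S | pop k f v S | load f v S =>
    intro emb next hM
    simp [flip, hM, code]
  | @seq p q s t m₁ m₂ m₃ _ _ ih₁ ih₂ =>
    intro emb next hM
    rw [Nat.add_comm, iterate_add_apply]
    erw [ih₁ (fun a => emb (Sum.inl a)) (emb (Sum.inr q.entry)) fun l => hM (Sum.inl l)]
    exact ih₂ (fun a => emb (Sum.inr a)) next fun l => hM (Sum.inr l)
  | @switch ι fin f p t m m' _ ih =>
    intro emb next hM
    rw [Nat.add_comm, iterate_add_apply, iterate_one]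
    have h0 := hM none
    simp only [code, Option.elim] at h0
    simp only [flip, Option.bind_eq_bind, Option.bind_some, entry, TM2.step, h0, TM2.stepAux]
    exact ih (fun b => emb (some ⟨f m.1, b⟩)) next fun l => hM (some ⟨f m.1, l⟩)
  | @loop_exit c p m hc =>
    intro emb next hM
    have h0 := hM none
    simp only [code, Option.elim] at h0
    simp [flip, entry, TM2.step, h0, TM2.stepAux, hc]
  | @loop_step c p s t m₁ m₂ m₃ hc _ _ ih₁ ih₂ =>
    intro emb next hM
    rw [Nat.add_comm, iterate_add_apply, Nat.add_comm, iterate_add_apply, iterate_one]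
    have h0 := hM none
    simp only [code, Option.elim] at h0
    simp only [flip, Option.bind_eq_bind, Option.bind_some, entry, TM2.step, h0, TM2.stepAux, hc,
      cond_true]
    have h1 := ih₁ (fun b => emb (some b)) (emb none) fun l => hM (some l)
    have h2 := ih₂ emb next hM
    simp only [Option.bind_eq_bind, entry] at h1 h2
    rw [h1, h2]

/-- `p.Runs t m m'`: the program `p`, started with memory `m`, ends with memory `m'` after at most
`t` steps. -/
def Runs (p : Prog Γ σ) (t : ℕ) (m m' : Mem Γ σ) : Prop := ∃ s ≤ t, Exec p s m m'

theorem Runs.mono {p : Prog Γ σ} {s t : ℕ} {m m' : Mem Γ σ} (h : p.Runs s m m') (hst : s ≤ t) :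
    p.Runs t m m' :=
  let ⟨r, hr, he⟩ := h
  ⟨r, hr.trans hst, he⟩

theorem Exec.runs {p : Prog Γ σ} {t : ℕ} {m m' : Mem Γ σ} (h : Exec p t m m') : p.Runs t m m' :=
  ⟨t, le_rfl, h⟩

theorem Runs.seq {p q : Prog Γ σ} {s t : ℕ} {m₁ m₂ m₃ : Mem Γ σ} (hp : p.Runs s m₁ m₂)
    (hq : q.Runs t m₂ m₃) : (p ;; q).Runs (s + t) m₁ m₃ :=
  let ⟨_, hr, he⟩ := hp
  let ⟨_, hr', he'⟩ := hq
  ⟨_, Nat.add_le_add hr hr', he.seq he'⟩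

theorem Runs.switch {ι : Type} {fin : Fintype ι} {f : σ → ι} {p : ι → Prog Γ σ} {t : ℕ}
    {m m' : Mem Γ σ} (h : (p (f m.1)).Runs t m m') :
    (Prog.switch ι fin f p).Runs (1 + t) m m' :=
  let ⟨_, hr, he⟩ := h
  ⟨_, Nat.add_le_add_left hr 1, he.switch⟩

theorem Runs.loop_step {c : σ → Bool} {p : Prog Γ σ} {s t : ℕ} {m₁ m₂ m₃ : Mem Γ σ}
    (hc : c m₁.1 = true) (hp : p.Runs s m₁ m₂) (hl : (loop c p).Runs t m₂ m₃) :
    (loop c p).Runs (1 + s + t) m₁ m₃ :=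
  let ⟨_, hr, he⟩ := hp
  let ⟨_, hr', he'⟩ := hl
  ⟨_, by omega, Exec.loop_step hc he he'⟩

/-- The multi-stack Turing machine that executes a program and then halts. -/
noncomputable abbrev toFinTM2 [Fintype K] [Fintype σ] (k₀ k₁ : K) [Fintype (Γ k₀)] (v₀ : σ)
    (p : Prog Γ σ) : FinTM2 where
  K := K
  k₀ := k₀
  k₁ := k₁
  Γ := Γ
  Λ := Option p.Lbl
  main := some p.entry
  ΛFin := letI := p.fintypeLbl; inferInstance
  σ := σ
  initialState := v₀
  m l := Option.elim l .halt fun a => p.code some none a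

/-! ### Programs as halting machines -/

theorem initList_eq (M : FinTM2) (l : List (M.Γ M.k₀)) :
    initList M l = ⟨some M.main, M.initialState, update (fun _ => []) M.k₀ l⟩ := by
  unfold initList
  congr 1
  funext k
  by_cases h : k = M.k₀
  · subst h; simp
  · simp [h]

theorem haltList_eq (M : FinTM2) (l : List (M.Γ M.k₁)) :
    haltList M l = ⟨none, M.initialState, update (fun _ => []) M.k₁ l⟩ := by
  unfold haltList
  congr 1
  funext k
  by_cases h : k = M.k₁
  · subst h; simp
  · simp [h]

/-- The strict inequality `t < u` pays for the final `halt`. As `haltList` fixes the whole final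
configuration, a program has to restore `v₀` and to empty all stacks except the output stack; hence
the erasures at the end of later programs. -/
theorem Runs.outputsInTime [Fintype K] [Fintype σ] {k₀ k₁ : K} [Fintype (Γ k₀)] {v₀ : σ}
    {p : Prog Γ σ} {t u : ℕ} {l : List (Γ k₀)} {l' : List (Γ k₁)}
    (h : p.Runs t (v₀, update (fun _ => []) k₀ l) (v₀, update (fun _ => []) k₁ l')) (htu : t < u) :
    Nonempty (TM2OutputsInTime (p.toFinTM2 k₀ k₁ v₀) l (some l') u) := by
  obtain ⟨s, hs, he⟩ := h
  refine ⟨{ steps := s + 1, evals_in_steps := ?_, steps_le_m := hs.trans_lt htu }⟩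
  rw [Nat.add_comm, iterate_add_apply, initList_eq]
  have := he.iterate_step (M := (p.toFinTM2 k₀ k₁ v₀).m) some none fun l => rfl
  erw [this]
  rw [Option.map_some, haltList_eq]
  rfl

end Prog

end SymAlt

namespace SymAlt

open Turing Function

namespace Prog

/-! ### Loops controlled by a stack -/

section Register

variable {K : Type} {Γ : K → Type} {τ : Type}

/-- The contents of the register: the last symbol popped, `none` if the stack was empty. -/
abbrev Reg : Type := Option (Option Bool)

/-- Pop a symbol into the register. -/
def popR (k : K) (d : Γ k → Option Bool) : Prog Γ (Reg × τ) := pop k fun v a => (a.map d, v.2)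

/-- Push the symbol in the register. -/
def pushR (k : K) (e : Option Bool → Γ k) : Prog Γ (Reg × τ) := push k fun v => e (v.1.getD none)

/-- Push a fixed symbol. -/
def pushC (k : K) (a : Γ k) : Prog Γ (Reg × τ) := push k fun _ => a

/-- Empty the register. -/
def skip : Prog Γ (Reg × τ) := load fun v => (none, v.2)

/-- Branch on the contents of the register. -/
def ite (c : Reg → Bool) (p q : Prog Γ (Reg × τ)) : Prog Γ (Reg × τ) :=
  switch Bool inferInstance (fun v => c v.1) fun b => Bool.rec q p b

/-- Pop symbols from a stack, and execute `p` for each of them, until the stack is empty. -/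
def forPop (k : K) (d : Γ k → Option Bool) (p : Prog Γ (Reg × τ)) : Prog Γ (Reg × τ) :=
  popR k d ;; loop (fun v => v.1.isSome) (p ;; popR k d)

variable [DecidableEq K]

/-- The program `p`, started with any symbol in the register, transforms the stacks `S` to `S'`
within `t` steps, and ends with an empty register. -/
def Sub (p : Prog Γ (Reg × τ)) (z : τ) (t : ℕ) (S S' : ∀ k, List (Γ k)) : Prop :=
  ∀ r, p.Runs t ((r, z), S) ((none, z), S')

variable {z : τ} {S S' S'' : ∀ k, List (Γ k)} {s t : ℕ} {p q : Prog Γ (Reg × τ)}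

theorem Sub.mono (h : p.Sub z s S S') (hst : s ≤ t) : p.Sub z t S S' :=
  fun r => (h r).mono hst

theorem Sub.congr (h : p.Sub z s S S') (hst : s ≤ t) (hS : S' = S'') : p.Sub z t S S'' :=
  hS ▸ h.mono hst

theorem Sub.seq (hp : p.Sub z s S S') (hq : q.Sub z t S' S'') : (p ;; q).Sub z (s + t) S S'' :=
  fun r => (hp r).seq (hq none)

theorem runs_popR_cons {k : K} {d : Γ k → Option Bool} {a : Γ k} {l : List (Γ k)} (r : Reg)
    (h : S k = a :: l) : (popR k d).Runs 1 ((r, z), S) ((some (d a), z), update S k l) := by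
  have := Exec.pop k (fun (v : Reg × τ) a => (Option.map d a, v.2)) (r, z) S
  rw [h] at this
  exact this.runs

theorem runs_popR_nil {k : K} {d : Γ k → Option Bool} (r : Reg)
    (h : S k = []) : (popR k d).Runs 1 ((r, z), S) ((none, z), S) := by
  have := Exec.pop k (fun (v : Reg × τ) a => (Option.map d a, v.2)) (r, z) S
  rw [h, List.tail_nil, ← h, update_eq_self, h] at this
  exact this.runs

theorem runs_pushR {k : K} {e : Option Bool → Γ k} (b : Option Bool) :
    (pushR k e).Runs 1 ((some b, z), S) ((some b, z), update S k (e b :: S k)) :=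
  (Exec.push k (fun (v : Reg × τ) => e (v.1.getD none)) (some b, z) S).runs

theorem runs_pushC {k : K} {a : Γ k} {v : Reg × τ} :
    (pushC k a).Runs 1 (v, S) (v, update S k (a :: S k)) :=
  (Exec.push k _ v S).runs

theorem sub_skip : (skip : Prog Γ (Reg × τ)).Sub z 1 S S :=
  fun r => (Exec.load (fun v : Reg × τ => (none, v.2)) (r, z) S).runs

theorem Runs.ite_pos {c : Reg → Bool} {v : Reg × τ} {m : Mem Γ (Reg × τ)} (hc : c v.1 = true)
    (h : p.Runs t (v, S) m) : (Prog.ite c p q).Runs (t + 1) (v, S) m := by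
  rw [Nat.add_comm]
  refine Runs.switch ?_
  simpa only [hc] using h

theorem Runs.ite_neg {c : Reg → Bool} {v : Reg × τ} {m : Mem Γ (Reg × τ)} (hc : c v.1 = false)
    (h : q.Runs t (v, S) m) : (Prog.ite c p q).Runs (t + 1) (v, S) m := by
  rw [Nat.add_comm]
  refine Runs.switch ?_
  simpa only [hc] using h

theorem sub_forPop_nil {k : K} {d : Γ k → Option Bool} (h : S k = []) :
    (forPop k d p).Sub z 2 S S :=
  fun r => (runs_popR_nil r h).seq (Exec.loop_exit (by rfl)).runs

/-- The pop that closes the loop body is also the pop that opens the remaining run of `forPop`, so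
inverting the run `hl` splits off one round. The body may leave any register, since this pop
overwrites it. -/
theorem sub_forPop_cons {k : K} {d : Γ k → Option Bool} {a : Γ k} {l : List (Γ k)} {r' : Reg}
    (h : S k = a :: l) (hp : p.Runs s ((some (d a), z), update S k l) ((r', z), S'))
    (hl : (forPop k d p).Sub z t S' S'') : (forPop k d p).Sub z (s + t + 2) S S'' := by
  intro r
  obtain ⟨u, hu, he⟩ := hl r'
  cases he with
  | @seq _ _ u₁ u₂ _ m _ h₁ h₂ =>
    have key : (loop (fun v : Reg × τ => v.1.isSome) (p ;; popR k d)).Runs (1 + (s + u₁) + u₂)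
        ((some (d a), z), update S k l) ((none, z), S'') :=
      Runs.loop_step (by rfl) (hp.seq h₁.runs) h₂.runs
    exact ((runs_popR_cons r h).seq key).mono (by omega)

/-- Pop all symbols of a stack. -/
def clear (k : K) (d : Γ k → Option Bool) : Prog Γ (Reg × τ) := forPop k d skip

theorem sub_clear (k : K) (d : Γ k → Option Bool) (S : ∀ k, List (Γ k)) :
    (clear k d).Sub z (3 * (S k).length + 2) S (update S k []) := by
  generalize hl : S k = l
  induction l generalizing S with
  | nil => exact (sub_forPop_nil hl).congr (by simp) (by simp [← hl])
  | cons a l ih =>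
    have := ih (update S k l) (by simp)
    rw [update_idem] at this
    exact (sub_forPop_cons hl (sub_skip _) this).mono (by simp; omega)

/-- Move the symbols of the stack `a` to the stack `b`, which reverses their order. -/
def move (a : K) (d : Γ a → Option Bool) (b : K) (e : Option Bool → Γ b) : Prog Γ (Reg × τ) :=
  forPop a d (pushR b e)

theorem sub_move {a b : K} (hab : a ≠ b) (d : Γ a → Option Bool) (e : Option Bool → Γ b)
    (S : ∀ k, List (Γ k)) :
    (move a d b e).Sub z (3 * (S a).length + 2) S
      (update (update S a []) b (((S a).map fun x => e (d x)).reverse ++ S b)) := by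
  generalize hl : S a = l
  induction l generalizing S with
  | nil => exact (sub_forPop_nil hl).congr (by simp) (by simp [← hl])
  | cons x l ih =>
    have := ih (update (update S a l) b (e (d x) :: update S a l b)) (by simp [hab])
    refine (sub_forPop_cons hl (runs_pushR _) this).congr (by simp; omega) ?_
    funext j
    by_cases hb : j = b
    · subst hb; simp [hab.symm]
    by_cases ha : j = a
    · subst ha; simp [hb]
    simp [ha, hb]

/-- Move the symbols of the stack `a` to the stack `b`, which reverses their order, and push as many
copies of `y` onto the stack `c`. -/
def moveCount (a : K) (d : Γ a → Option Bool) (b : K) (e : Option Bool → Γ b) (c : K) (y : Γ c) :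
    Prog Γ (Reg × τ) :=
  forPop a d (pushR b e ;; pushC c y)

theorem sub_moveCount {a b c : K} (hab : a ≠ b) (hac : a ≠ c) (hbc : b ≠ c)
    (d : Γ a → Option Bool) (e : Option Bool → Γ b) (y : Γ c) (S : ∀ k, List (Γ k)) :
    (moveCount a d b e c y).Sub z (4 * (S a).length + 2) S
      (update (update (update S a []) b (((S a).map fun x => e (d x)).reverse ++ S b)) c
        (List.replicate (S a).length y ++ S c)) := by
  have hba := hab.symm
  have hca := hac.symm
  have hcb := hbc.symm
  generalize hl : S a = l
  induction l generalizing S with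
  | nil =>
    have : update (update (update S a []) b (S b)) c (S c) = S := by
      rw [← hl, update_eq_self, update_eq_self, update_eq_self]
    simp only [List.map_nil, List.reverse_nil, List.nil_append, List.length_nil,
      List.replicate_zero, this]
    exact sub_forPop_nil hl
  | cons x l ih =>
    have := ih (update (update (update S a l) b (e (d x) :: S b)) c (y :: S c)) (by simp [hab, hac])
    refine (sub_forPop_cons hl ((runs_pushR _).seq runs_pushC) (t := 4 * l.length + 2) ?_).congr
      (by simp; omega) rfl
    have h1 : update (update (update S a l) b (e (d x) :: update S a l b)) c
        (y :: update (update S a l) b (e (d x) :: update S a l b) c) =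
        update (update (update S a l) b (e (d x) :: S b)) c (y :: S c) := by
      simp [hba, hca, hcb]
    rw [h1]
    refine this.congr le_rfl ?_
    funext j
    by_cases hc : j = c
    · subst hc; simp [List.replicate_succ']
    by_cases hb : j = b
    · subst hb; simp [hc]
    by_cases ha : j = a
    · subst ha; simp [hc, hb]
    simp [ha, hb, hc]

/-- The symbols that `takeTo` writes, for `n` symbols on the counter and `l` on the source. -/
def takeOr {α β : Type} (f : α → β) (o : Option β) : ℕ → List α → List β
  | 0, _ => []
  | n + 1, [] => o.toList ++ takeOr f o n []
  | n + 1, x :: l => f x :: takeOr f o n l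

/-- Without a default, the word is only cut, as in `verifyStep`. With a default (`takeOr_some`), it
is also padded to the exact length that a verifier for `S2TIME` requires of its proofs. -/
theorem takeOr_none {α β : Type} (f : α → β) (n : ℕ) (l : List α) :
    takeOr f none n l = (l.take n).map f := by
  induction n generalizing l with
  | zero => simp [takeOr]
  | succ n ih => cases l <;> simp [takeOr, ih]

theorem takeOr_some {α : Type} (y : α) (n : ℕ) (l : List α) :
    takeOr id (some y) n l = l.takeD n y := by
  induction n generalizing l with
  | zero => simp [takeOr]
  | succ n ih => cases l <;> simp [takeOr, ih]

/-- Move symbols of the stack `a` to the stack `b`, one for each symbol on the counter `k`. If `a`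
has too few of them, then the symbol `o`, if any, is used instead. -/
def takeTo (k : K) (d' : Γ k → Option Bool) (a : K) (d : Γ a → Option Bool) (b : K)
    (e : Option Bool → Γ b) (o : Option (Γ b)) : Prog Γ (Reg × τ) :=
  forPop k d' (popR a d ;; ite (fun r => r.isSome) (pushR b e) (o.elim skip (pushC b)))

theorem sub_takeTo {k a b : K} (hka : k ≠ a) (hkb : k ≠ b) (hab : a ≠ b)
    (d' : Γ k → Option Bool) (d : Γ a → Option Bool) (e : Option Bool → Γ b) (o : Option (Γ b))
    (S : ∀ k, List (Γ k)) :
    (takeTo k d' a d b e o).Sub z (5 * (S k).length + 2) S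
      (update (update (update S k []) a ((S a).drop (S k).length)) b
        ((takeOr (fun x => e (d x)) o (S k).length (S a)).reverse ++ S b)) := by
  have hak := hka.symm
  have hbk := hkb.symm
  have hba := hab.symm
  generalize hl : S k = l
  induction l generalizing S with
  | nil =>
    refine (sub_forPop_nil hl).congr (by simp) ?_
    funext j
    by_cases hb : j = b
    · subst hb; simp [takeOr]
    by_cases ha : j = a
    · subst ha; simp [hb]
    by_cases hk : j = k
    · subst hk; simp [hb, ha, hl]
    simp [ha, hb, hk]
  | cons x l ih =>
    cases hy : S a with
    | nil =>
      have h1 := ih (update (update S k l) b (o.toList ++ S b)) (by simp [hkb])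
      have hp : (popR a d ;; ite (fun r => r.isSome) (pushR b e) (o.elim skip (pushC b))).Runs 3
          ((some (d' x), z), update S k l)
          ((none, z), update (update S k l) b (o.toList ++ S b)) := by
        refine (runs_popR_nil _ (by simpa [hak] using hy)).seq (t := 2) (Runs.ite_neg rfl ?_)
        cases o with
        | none =>
          have : update (update S k l) b ((none : Option (Γ b)).toList ++ S b) = update S k l := by
            rw [update_eq_self_iff]; simp [hbk]
          rw [this]
          exact sub_skip none
        | some y =>
          have := runs_pushC (S := update S k l) (k := b) (a := y) (v := (none, z))
          rw [update_of_ne hbk] at this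
          exact this
      refine (sub_forPop_cons hl hp h1).congr (by simp; omega) ?_
      funext j
      by_cases hb : j = b
      · subst hb; simp [takeOr, hy, hab, hak]; cases o <;> simp
      by_cases ha : j = a
      · subst ha; simp [hb, hy, hak]
      by_cases hk : j = k
      · subst hk; simp [hb, ha]
      simp [ha, hb, hk]
    | cons y m =>
      have h1 := ih (update (update (update S k l) a m) b (e (d y) :: S b)) (by simp [hkb, hka])
      have hp : (popR a d ;; ite (fun r => r.isSome) (pushR b e) (o.elim skip (pushC b))).Runs 3
          ((some (d' x), z), update S k l)
          ((some (d y), z), update (update (update S k l) a m) b (e (d y) :: S b)) := by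
        refine (runs_popR_cons _ (by simpa [hak] using hy)).seq (t := 2) (Runs.ite_pos rfl ?_)
        have := runs_pushR (S := update (update S k l) a m) (k := b) (e := e) (z := z) (d y)
        rw [update_of_ne hba, update_of_ne hbk] at this
        exact this
      refine (sub_forPop_cons hl hp h1).congr (by simp; omega) ?_
      funext j
      by_cases hb : j = b
      · subst hb; simp [takeOr, hab]
      by_cases ha : j = a
      · subst ha; simp [hb]
      by_cases hk : j = k
      · subst hk; simp [hb, ha]
      simp [ha, hb, hk]

end Register

end Prog
end SymAlt

namespace SymAlt

open Turing Function

/-! ### Programs that call a multi-stack Turing machine -/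

/-- The names of the binary work stacks. -/
inductive WorkStack
  | out | x | y | p | q | acc | cnt | aux | tmp | fuel
  deriving DecidableEq

instance : Fintype WorkStack :=
  ⟨{.out, .x, .y, .p, .q, .acc, .cnt, .aux, .tmp, .fuel}, fun i => by cases i <;> simp⟩

/-- The contents of the work stacks. -/
@[ext] structure Data where
  out : List Bool := []
  x : List Bool := []
  y : List Bool := []
  p : List Bool := []
  q : List Bool := []
  acc : List Bool := []
  cnt : List Bool := []
  aux : List Bool := []
  tmp : List Bool := []
  fuel : List Bool := []

namespace Data

/-- The contents of a work stack. -/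
def get (s : Data) : WorkStack → List Bool
  | .out => s.out
  | .x => s.x
  | .y => s.y
  | .p => s.p
  | .q => s.q
  | .acc => s.acc
  | .cnt => s.cnt
  | .aux => s.aux
  | .tmp => s.tmp
  | .fuel => s.fuel

/-- Replace the contents of a work stack. -/
def set (s : Data) : WorkStack → List Bool → Data
  | .out, l => { s with out := l }
  | .x, l => { s with x := l }
  | .y, l => { s with y := l }
  | .p, l => { s with p := l }
  | .q, l => { s with q := l }
  | .acc, l => { s with acc := l }
  | .cnt, l => { s with cnt := l }
  | .aux, l => { s with aux := l }
  | .tmp, l => { s with tmp := l }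
  | .fuel, l => { s with fuel := l }

theorem get_set (s : Data) (i : WorkStack) (l : List Bool) :
    (s.set i l).get = update s.get i l := by
  funext j
  cases i <;> cases j <;> rfl

/-- Reduces equality of records to equality of functions of the stack name, where `get_set` turns
assignments into `update` and a case split on names decides. -/
theorem get_injective : Injective get := by
  intro s t h
  ext1
  · exact congrFun h .out
  · exact congrFun h .x
  · exact congrFun h .y
  · exact congrFun h .p
  · exact congrFun h .q
  · exact congrFun h .acc
  · exact congrFun h .cnt
  · exact congrFun h .aux
  · exact congrFun h .tmp
  · exact congrFun h .fuel

end Data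

/-- The stacks of a program that calls `M`: the input stack, the work stacks and the stacks
of `M`. -/
abbrev Stk (M : FinTM2) : Type := Option WorkStack ⊕ M.K

/-- The alphabets of the stacks. -/
abbrev Alph (M : FinTM2) : Stk M → Type
  | .inl none => Option Bool
  | .inl (some _) => Bool
  | .inr k => M.Γ k

/-- The programs that call `M`. -/
abbrev MProg (M : FinTM2) : Type 1 := Prog (Alph M) (Prog.Reg × M.σ × Option M.Λ)

/-- The contents of all stacks. -/
def stk {M : FinTM2} (I : List (Option Bool)) (s : Data) (S : ∀ k, List (M.Γ k)) :
    ∀ k, List (Alph M k)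
  | .inl none => I
  | .inl (some i) => s.get i
  | .inr k => S k

section

variable {M : FinTM2} (I : List (Option Bool)) (s : Data) (S : ∀ k, List (M.Γ k))

theorem update_stk_input (l : List (Option Bool)) :
    update (stk I s S) (Sum.inl none) l = stk l s S := by
  funext k
  rcases k with (_ | _) | _ <;> simp [stk]

theorem update_stk_work (i : WorkStack) (l : List Bool) :
    update (stk I s S) (Sum.inl (some i)) l = stk I (s.set i l) S := by
  funext k
  rcases k with (_ | j) | _
  · simp [stk]
  · by_cases h : j = i
    · subst h; simp [stk, Data.get_set]
    · simp [stk, Data.get_set, h]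
  · simp [stk]

theorem update_stk_machine (k : M.K) (l : List (M.Γ k)) :
    update (stk I s S) (Sum.inr k) l = stk I s (update S k l) := by
  funext j
  rcases j with (_ | _) | j
  · simp [stk]
  · simp [stk]
  · by_cases h : j = k
    · subst h; simp [stk]
    · simp [stk, h]

end

/-- The machine state between the calls of `M`. -/
abbrev idle (M : FinTM2) : M.σ × Option M.Λ := (M.initialState, none)

/-- The program `p` changes the contents of the stacks from `(I, s, S)` to `(I', s', S')` within
`t` steps. -/
abbrev Effect {M : FinTM2} (p : MProg M) (t : ℕ) (I : List (Option Bool)) (s : Data)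
    (S : ∀ k, List (M.Γ k)) (I' : List (Option Bool)) (s' : Data) (S' : ∀ k, List (M.Γ k)) : Prop :=
  Prog.Sub p (idle M) t (stk I s S) (stk I' s' S')

namespace MProg

open Prog

variable {M : FinTM2}

/-- Execute one statement of `M`. -/
def simStmt : TM2.Stmt M.Γ M.Λ M.σ → MProg M
  | .push k f q => Prog.push (Sum.inr k) (fun v => f v.2.1) ;; simStmt q
  | .peek k f q => Prog.peek (Sum.inr k) (fun v a => (v.1, f v.2.1 a, v.2.2)) ;; simStmt q
  | .pop k f q => Prog.pop (Sum.inr k) (fun v a => (v.1, f v.2.1 a, v.2.2)) ;; simStmt q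
  | .load f q => Prog.load (fun v => (v.1, f v.2.1, v.2.2)) ;; simStmt q
  | .branch f q₁ q₂ =>
    Prog.switch Bool inferInstance (fun v => f v.2.1) fun b => cond b (simStmt q₁) (simStmt q₂)
  | .goto f => Prog.load fun v => (v.1, v.2.1, some (f v.2.1))
  | .halt => Prog.load fun v => (v.1, v.2.1, none)

/-- A bound on the number of steps of `simStmt`. -/
def stmtTime : TM2.Stmt M.Γ M.Λ M.σ → ℕ
  | .push _ _ q | .peek _ _ q | .pop _ _ q | .load _ q => 1 + stmtTime q
  | .branch _ q₁ q₂ => 1 + (stmtTime q₁ + stmtTime q₂)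
  | .goto _ | .halt => 1

/-- One step of `M` executes a whole statement, each constructor of which costs a program step.
`stmtTime` adds up both branches, and so bounds either one. -/
theorem simStmt_runs (q : TM2.Stmt M.Γ M.Λ M.σ) (r : Reg) (v : M.σ) (l : Option M.Λ)
    (I : List (Option Bool)) (s : Data) (S : ∀ k, List (M.Γ k)) :
    (simStmt q).Runs (stmtTime q) ((r, v, l), stk I s S)
      ((r, (TM2.stepAux q v S).var, (TM2.stepAux q v S).l),
        stk I s (TM2.stepAux q v S).stk) := by
  induction q generalizing v S with
  | push k f q ih =>
    refine Runs.seq ?_ (ih v _)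
    rw [← update_stk_machine]
    exact (Exec.push (Γ := Alph M) (Sum.inr k) (fun v : Reg × M.σ × Option M.Λ => f v.2.1)
      (r, v, l) (stk I s S)).runs
  | peek k f q ih =>
    refine Runs.seq ?_ (ih _ S)
    exact (Exec.peek (Γ := Alph M) (Sum.inr k)
      (fun (v : Reg × M.σ × Option M.Λ) a => (v.1, f v.2.1 a, v.2.2)) (r, v, l) (stk I s S)).runs
  | pop k f q ih =>
    refine Runs.seq ?_ (ih _ _)
    rw [← update_stk_machine]
    exact (Exec.pop (Γ := Alph M) (Sum.inr k)
      (fun (v : Reg × M.σ × Option M.Λ) a => (v.1, f v.2.1 a, v.2.2)) (r, v, l) (stk I s S)).runs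
  | load f q ih =>
    refine Runs.seq ?_ (ih _ S)
    exact (Exec.load (fun v : Reg × M.σ × Option M.Λ => (v.1, f v.2.1, v.2.2))
      (r, v, l) (stk I s S)).runs
  | branch f q₁ q₂ ih₁ ih₂ =>
    refine Runs.switch ?_
    rw [TM2.stepAux]
    cases h : f v with
    | false =>
      have := (ih₂ v S).mono (Nat.le_add_left _ (stmtTime q₁))
      simpa only [h, cond_false] using this
    | true =>
      have := (ih₁ v S).mono (Nat.le_add_right _ (stmtTime q₂))
      simpa only [h, cond_true] using this
  | goto f => exact (Exec.load _ _ _).runs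
  | halt => exact (Exec.load _ _ _).runs

/-- Run `M`. -/
noncomputable def sim : MProg M :=
  Prog.load (fun v => (none, v.2.1, some M.main)) ;;
    Prog.loop (fun v => v.2.2.isSome)
      (Prog.switch M.Λ M.ΛFin (fun v => v.2.2.getD M.main) fun l => simStmt (M.m l))

theorem exists_stmtTime_le (M : FinTM2) : ∃ C, ∀ l, stmtTime (M.m l) ≤ C :=
  letI := M.ΛFin
  ⟨Finset.univ.sup fun l => stmtTime (M.m l),
    fun l => Finset.le_sup (f := fun l => stmtTime (M.m l)) (Finset.mem_univ l)⟩

/-- The simulation of `M` is slower than `M` by a constant factor only. -/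
theorem exists_sim_effect (M : FinTM2) : ∃ C : ℕ, ∀ (t : ℕ) (l : List (M.Γ M.k₀))
    (l' : List (M.Γ M.k₁)), Nonempty (TM2OutputsInTime M l (some l') t) →
      ∀ I s, Effect (sim : MProg M) (C * t + 2) I s (update (fun _ => []) M.k₀ l) I s
        (update (fun _ => []) M.k₁ l') := by
  obtain ⟨C, hC⟩ := exists_stmtTime_le M
  -- Besides the statement, a simulated step costs one loop test and one switch on the label. The
  -- summand `2` of the total pays for the initial load and the exit from the loop.
  refine ⟨C + 2, ?_⟩
  rintro t l l' ⟨⟨⟨n, hn⟩, hnt⟩⟩ I s r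
  have key : ∀ (n : ℕ) (c c' : TM2.Cfg M.Γ M.Λ M.σ),
      (flip bind (TM2.step M.m))^[n] (some c) = some c' → c'.l = none →
      (Prog.loop (fun v : Reg × M.σ × Option M.Λ => v.2.2.isSome)
        (Prog.switch M.Λ M.ΛFin (fun v => v.2.2.getD M.main) fun l => simStmt (M.m l))).Runs
        ((C + 2) * n + 1) ((none, c.var, c.l), stk I s c.stk)
          ((none, c'.var, c'.l), stk I s c'.stk) := by
    intro n
    induction n with
    | zero =>
      intro c c' h h'
      obtain rfl : c = c' := by simpa using h
      exact (Exec.loop_exit (by simp [h'])).runs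
    | succ n ih =>
      rintro ⟨_ | l, v, T⟩ c' h h'
      · rw [iterate_succ_apply] at h
        -- A halted configuration has no successor, so it cannot have steps left.
        have h0 : ∀ n, (flip bind (TM2.step M.m))^[n] none = none := fun n =>
          iterate_fixed rfl n
        exact absurd ((h0 n).symm.trans h) (by simp)
      · have h1 := ih (TM2.stepAux (M.m l) v T) c' (by rwa [iterate_succ_apply] at h) h'
        have h2 := simStmt_runs (M.m l) none v (some l) I s T
        refine (Runs.loop_step rfl (Runs.switch h2) h1).mono ?_
        have := hC l
        rw [Nat.mul_succ]
        omega
  rw [initList_eq, Option.map_some, haltList_eq] at hn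
  have h1 := key n _ _ hn rfl
  have h2 := (Exec.load (fun v : Reg × M.σ × Option M.Λ => (none, v.2.1, some M.main))
    (r, idle M) (stk I s (update (fun _ => []) M.k₀ l))).runs
  refine (h2.seq h1).mono ?_
  have : (C + 2) * n ≤ (C + 2) * t := Nat.mul_le_mul_left _ hnt
  omega

end MProg

end SymAlt

namespace SymAlt

open Turing Function

namespace MProg

open Prog

variable {M : FinTM2} {I : List (Option Bool)} {s : Data} {S : ∀ k, List (M.Γ k)}

/-! ### Routines on the work stacks -/

/-- The position of a work stack. -/
abbrev work (i : WorkStack) : Stk M := Sum.inl (some i)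

theorem work_ne {i j : WorkStack} (h : i ≠ j) : (work i : Stk M) ≠ work j := by
  simpa using h

/-- Execute `p` for each symbol of a work stack. -/
def each (i : WorkStack) (p : MProg M) : MProg M := forPop (work i) some p

/-- Push a bit onto a work stack. -/
def put (i : WorkStack) (b : Bool) : MProg M := pushC (work i) b ;; skip

theorem put_effect (i : WorkStack) (b : Bool) :
    Effect (put i b : MProg M) 2 I s S I (s.set i (b :: s.get i)) S := by
  intro r
  rw [← update_stk_work]
  exact runs_pushC.seq (sub_skip r)

/-- Drop a symbol from a work stack. -/
def drop (i : WorkStack) : MProg M := popR (work i) some ;; skip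

theorem drop_effect (i : WorkStack) :
    Effect (drop i : MProg M) 2 I s S I (s.set i (s.get i).tail) S := by
  intro r
  rw [← update_stk_work]
  exact (Exec.pop (Γ := Alph M) (work i) (fun (v : Reg × M.σ × Option M.Λ) a => (a.map some, v.2))
    (r, idle M) (stk I s S)).runs.seq (sub_skip _)

/-- Empty a work stack. -/
def erase (i : WorkStack) : MProg M := clear (work i) some

theorem erase_effect (i : WorkStack) :
    Effect (erase i : MProg M) (3 * (s.get i).length + 2) I s S I (s.set i []) S := by
  rw [Effect, ← update_stk_work]
  exact sub_clear (work i) some (stk I s S)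

/-- Move the contents of a work stack to another one, in reverse order. -/
def shift (i j : WorkStack) : MProg M :=
  move (work i) some (work j) (fun b => (b.getD false : Bool))

theorem shift_effect {i j : WorkStack} (h : i ≠ j) :
    Effect (shift i j : MProg M) (3 * (s.get i).length + 2) I s S I
      ((s.set i []).set j ((s.get i).reverse ++ s.get j)) S := by
  have := sub_move (z := idle M) (work_ne h) some (fun b => (b.getD false : Bool)) (stk I s S)
  rw [update_stk_work, update_stk_work] at this
  refine this.congr le_rfl ?_
  simp [stk]

/-- Push onto `j` as many symbols as there are on `i`; `t` is used as an auxiliary stack. -/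
def count (i t j : WorkStack) : MProg M :=
  moveCount (work i) some (work t) (fun b => (b.getD false : Bool)) (work j) true ;; shift t i

/-- Moving `i` to `t` reverses it and moving it back undoes this. The stack `t` must be empty, or
its old contents would end up on `i`. -/
theorem count_effect {i t j : WorkStack} (hit : i ≠ t) (hij : i ≠ j) (htj : t ≠ j)
    (ht : s.get t = []) :
    Effect (count i t j : MProg M) (7 * (s.get i).length + 4) I s S I
      (s.set j (List.replicate (s.get i).length true ++ s.get j)) S := by
  have h1 := sub_moveCount (z := idle M) (work_ne hit) (work_ne hij) (work_ne htj) some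
    (fun b => (b.getD false : Bool)) true (stk I s S)
  rw [update_stk_work, update_stk_work, update_stk_work] at h1
  refine (h1.seq (shift_effect hit.symm)).congr ?_ ?_
  · simp [stk, Data.get_set, htj, ht]
    omega
  · congr 1
    apply Data.get_injective
    have hti := hit.symm
    have hji := hij.symm
    have hjt := htj.symm
    funext k
    simp only [Data.get_set, stk, update_apply]
    split_ifs <;> simp_all

/-- Replace `n` symbols on `i` by `2 * n` symbols; `t` is used as an auxiliary stack. -/
def double (i t : WorkStack) : MProg M := each i (put t true ;; put t true) ;; shift t i

theorem each_put_put_effect {i t : WorkStack} (hit : i ≠ t) :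
    Effect (each i (put t true ;; put t true) : MProg M) (6 * (s.get i).length + 2) I s S I
      ((s.set i []).set t (List.replicate (2 * (s.get i).length) true ++ s.get t)) S := by
  generalize hl : s.get i = l
  induction l generalizing s with
  | nil =>
    refine (sub_forPop_nil (by simpa [stk] using hl)).congr (by simp) ?_
    congr 1
    apply Data.get_injective
    funext k
    simp only [Data.get_set, update_apply]
    split_ifs <;> simp_all
  | cons x l ih =>
    have h1 : Effect (each i (put t true ;; put t true) : MProg M) _ I _ S I _ S :=
      ih (s := (s.set i l).set t (true :: true :: s.get t)) (by simp [Data.get_set, hit])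
    refine (sub_forPop_cons (a := x) (l := l) (r' := none) (s := 4)
      (S' := stk I ((s.set i l).set t (true :: true :: s.get t)) S) (by simpa [stk] using hl)
      ?_ h1).congr (by simp; omega) ?_
    · rw [update_stk_work]
      have h2 := (put_effect (M := M) (I := I) (S := S) (s := s.set i l) t true).seq
        (put_effect t true)
      refine (h2.congr le_rfl ?_) _
      congr 1
      apply Data.get_injective
      simp [Data.get_set, hit.symm]
    · congr 1
      apply Data.get_injective
      have hti := hit.symm
      funext k
      simp only [Data.get_set, update_apply]
      split_ifs <;> simp_all [Nat.mul_succ, List.replicate_succ']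

theorem double_effect {i t : WorkStack} (hit : i ≠ t) (ht : s.get t = []) :
    Effect (double i t : MProg M) (12 * (s.get i).length + 4) I s S I
      (s.set i (List.replicate (2 * (s.get i).length) true)) S := by
  refine ((each_put_put_effect hit).seq (shift_effect hit.symm)).congr ?_ ?_
  · simp [Data.get_set, ht]
    omega
  · congr 1
    apply Data.get_injective
    have hti := hit.symm
    funext k
    simp only [Data.get_set, update_apply]
    split_ifs <;> simp_all

/-- Move symbols from `i` to `j`, one for each symbol on `k`; if `i` has too few of them, then
`o`, if any, is used instead. -/
def takeWork (k i j : WorkStack) (o : Option Bool) : MProg M :=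
  takeTo (work k) some (work i) some (work j) (fun b => (b.getD false : Bool)) o

theorem takeWork_effect {k i j : WorkStack} (hki : k ≠ i) (hkj : k ≠ j) (hij : i ≠ j)
    (o : Option Bool) :
    Effect (takeWork k i j o : MProg M) (5 * (s.get k).length + 2) I s S I
      (((s.set k []).set i ((s.get i).drop (s.get k).length)).set j
        ((takeOr id o (s.get k).length (s.get i)).reverse ++ s.get j)) S := by
  have := sub_takeTo (z := idle M) (work_ne hki) (work_ne hkj) (work_ne hij) some some
    (fun b => (b.getD false : Bool)) o (stk I s S)
  rw [update_stk_work, update_stk_work, update_stk_work] at this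
  exact this

/-- Read the next block of the input, up to a separator, onto the work stack `j`. -/
def readBlock (j : WorkStack) : MProg M :=
  (popR (Sum.inl none) id ;; loop (fun v => v.1.join.isSome)
    (pushR (work j) (fun b => (b.getD false : Bool)) ;; popR (Sum.inl none) id)) ;; skip

/-- The hypothesis `hl` covers both ends of a block, the separator and the end of the input; `join`
in the loop test identifies them in the same way. -/
theorem readBlock_effect (j : WorkStack) (w : List Bool) (l : List (Option Bool))
    (hl : l.head?.join = none) :
    Effect (readBlock j : MProg M) (3 * w.length + 3) (w.map some ++ l) s S l.tail
      (s.set j (w.reverse ++ s.get j)) S := by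
  intro r
  refine Runs.seq (t := 1)
    (m₂ := ((l.head?, idle M), stk l.tail (s.set j (w.reverse ++ s.get j)) S)) ?_ (sub_skip _)
  induction w generalizing s r with
  | nil =>
    refine Runs.seq (s := 1) (t := 1) (m₂ := ((l.head?, idle M), stk l.tail s S)) ?_ ?_
    · have := (Exec.pop (Γ := Alph M) (Sum.inl none)
        (fun (v : Reg × M.σ × Option M.Λ) a => (a.map id, v.2)) (r, idle M) (stk l s S)).runs
      rw [update_stk_input] at this
      simpa [stk, popR] using this
    · have hs : s.set j (([] : List Bool).reverse ++ s.get j) = s := by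
        apply Data.get_injective
        simp [Data.get_set]
      rw [hs]
      exact (Exec.loop_exit (by simp [hl])).runs
  | cons b w ih =>
    obtain ⟨u, hu, he⟩ := ih (s := s.set j (b :: s.get j)) (some (some b))
    cases he with
    | @seq _ _ u₁ u₂ _ m _ h₁ h₂ =>
      have hp := (Exec.pop (Γ := Alph M) (Sum.inl none)
        (fun (v : Reg × M.σ × Option M.Λ) a => (a.map id, v.2)) (r, idle M)
        (stk (some b :: (w.map some ++ l)) s S)).runs
      rw [update_stk_input] at hp
      have hq := runs_pushR (z := idle M) (S := stk (w.map some ++ l) s S) (k := work j)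
        (e := fun b => (b.getD false : Bool)) (some b)
      rw [update_stk_work] at hq
      have hs : (s.set j (b :: s.get j)).set j (w.reverse ++ (s.set j (b :: s.get j)).get j) =
          s.set j ((b :: w).reverse ++ s.get j) := by
        apply Data.get_injective
        simp [Data.get_set]
      rw [hs] at h₂
      exact (hp.seq (Runs.loop_step rfl (hq.seq h₁.runs) h₂.runs)).mono (by simp; omega)

end MProg

end SymAlt

namespace SymAlt

open Turing Function

namespace MProg

open Prog

variable {M : FinTM2} {I : List (Option Bool)} {s : Data} {S : ∀ k, List (M.Γ k)}

/-! ### Arithmetic in unary notation -/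

/-- The number with binary digits `m` followed by `x`. -/
def binVal (m : ℕ) (x : List Bool) : ℕ := x.foldl (fun a b => 2 * a + b.toNat) m

theorem le_binVal (m : ℕ) (x : List Bool) : m ≤ binVal m x := by
  induction x generalizing m with
  | nil => exact le_rfl
  | cons b x ih => exact le_trans (by omega) (ih (2 * m + b.toNat))

/-- Compute in unary the number with the binary digits on `x`. -/
def evalBinary : MProg M :=
  each .x (ite (fun r => r == some (some true)) (double .acc .tmp ;; put .acc true)
    (double .acc .tmp))

/-- Horner's scheme. The partial values never decrease (`le_binVal`), so a bound `B` on the last one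
bounds the cost of every doubling. -/
theorem evalBinary_effect {x : List Bool} {m B : ℕ} (hB : binVal m x ≤ B) (hx : s.x = x)
    (ht : s.tmp = []) (hm : s.acc = List.replicate m true) :
    Effect (evalBinary : MProg M) (x.length * (12 * B + 9) + 2) I s S I
      { s with x := [], acc := List.replicate (binVal m x) true } S := by
  induction x generalizing m s with
  | nil =>
    refine (sub_forPop_nil (show stk I s S (work .x) = [] from hx)).congr (by simp) ?_
    congr 1
    ext1 <;> first | rfl | assumption
  | cons b x ih =>
    have h1 := ih (m := 2 * m + b.toNat)
      (s := { s with x := x, acc := List.replicate (2 * m + b.toNat) true }) hB rfl ht rfl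
    have hmB : m ≤ B := le_trans (by omega) ((le_binVal (2 * m + b.toNat) x).trans hB)
    refine (sub_forPop_cons (a := b) (l := x) (r' := none) (s := 12 * m + 7)
      (S' := stk I { s with x := x, acc := List.replicate (2 * m + b.toNat) true } S)
      hx ?_ h1).congr ?_ rfl
    · rw [update_stk_work]
      have hd : Effect (double .acc .tmp : MProg M) (12 * m + 4) I { s with x := x } S I
          { s with x := x, acc := List.replicate (2 * m) true } S := by
        refine (double_effect (s := { s with x := x }) (i := .acc) (t := .tmp) (by decide)
          ht).congr ?_ ?_
        · simp [Data.get, hm]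
        · simp [Data.get, Data.set, hm]
      cases b with
      | true =>
        exact Runs.ite_pos rfl (hd.seq (put_effect .acc true) _)
      | false =>
        exact Runs.ite_neg rfl ((hd _).mono (by omega))
    · have : 12 * m ≤ 12 * B := by omega
      simp only [List.length_cons, Nat.succ_mul]
      omega

/-- Execute a program `n` times. -/
def iter (p : MProg M) : ℕ → MProg M
  | 0 => skip
  | n + 1 => p ;; iter p n

theorem iter_put_effect (i : WorkStack) (n : ℕ) :
    Effect (iter (put i true) n : MProg M) (2 * n + 1) I s S I
      (s.set i (List.replicate n true ++ s.get i)) S := by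
  induction n generalizing s with
  | zero =>
    refine Sub.congr sub_skip le_rfl ?_
    congr 1
    apply Data.get_injective
    simp [Data.get_set]
  | succ n ih =>
    refine ((put_effect i true).seq ih).congr (by omega) ?_
    congr 1
    apply Data.get_injective
    simp [Data.get_set, List.replicate_succ']

/-- Double the counter `cnt` a fixed number of times. -/
theorem iter_double_effect {m B : ℕ} (n : ℕ) (hB : 2 ^ n * m ≤ B) (ht : s.tmp = [])
    (hm : s.cnt = List.replicate m true) :
    Effect (iter (double .cnt .tmp) n : MProg M) (n * (12 * B + 4) + 1) I s S I
      { s with cnt := List.replicate (2 ^ n * m) true } S := by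
  induction n generalizing s m with
  | zero =>
    refine Sub.congr sub_skip (by simp) ?_
    congr 1
    ext1 <;> simp [hm]
  | succ n ih =>
    have hmB : m ≤ B := le_trans (Nat.le_mul_of_pos_left m (by positivity)) hB
    have hd : Effect (double .cnt .tmp : MProg M) (12 * B + 4) I s S I
        { s with cnt := List.replicate (2 * m) true } S := by
      refine (double_effect (i := .cnt) (t := .tmp) (by decide) ht).congr ?_ ?_
      · simp [Data.get, hm]; omega
      · simp [Data.get, Data.set, hm]
    have h2 : 2 ^ n * (2 * m) = 2 ^ (n + 1) * m := by ring
    have h1 := ih (m := 2 * m) (s := { s with cnt := List.replicate (2 * m) true })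
      (h2 ▸ hB) ht rfl
    refine (hd.seq h1).congr ?_ ?_
    · rw [Nat.add_mul n 1, Nat.one_mul]; omega
    · simp only [h2]

theorem each_count_effect (hc : s.tmp = []) :
    Effect (each .aux (count .y .tmp .cnt) : MProg M)
      (s.aux.length * (7 * s.y.length + 6) + 2) I s S I
      { s with aux := [], cnt := List.replicate (s.aux.length * s.y.length) true ++ s.cnt } S := by
  generalize hl : s.aux = l
  induction l generalizing s with
  | nil =>
    refine (sub_forPop_nil (show stk I s S (work .aux) = [] from hl)).congr (by simp) ?_
    congr 1
    ext1 <;> simp [hl]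
  | cons b l ih =>
    have h1 := ih (s := { s with aux := l, cnt := List.replicate s.y.length true ++ s.cnt }) hc rfl
    have h2 := count_effect (M := M) (s := { s with aux := l }) (I := I) (S := S) (i := .y)
      (t := .tmp) (j := .cnt) (by decide) (by decide) (by decide) hc
    refine (sub_forPop_cons (a := b) (l := l) (r' := none) (s := 7 * s.y.length + 4)
      (S' := stk I { s with aux := l, cnt := List.replicate s.y.length true ++ s.cnt } S)
      hl ?_ h1).congr ?_ ?_
    · rw [update_stk_work]
      exact h2 _
    · simp only [List.length_cons, Nat.succ_mul]
      omega
    · congr 1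
      simp [Nat.succ_mul, ← List.append_assoc]

open Polynomial in
/-- The values of a polynomial can be computed in unary in polynomial time. -/
theorem exists_evalPolynomial (M : FinTM2) (P : ℕ[X]) :
    ∃ (p : MProg M) (R : ℕ[X]), ∀ (I : List (Option Bool)) (s : Data) (S : ∀ k, List (M.Γ k)),
      s.tmp = [] → s.aux = [] → s.cnt = [] →
      Effect p (R.eval s.y.length) I s S I
        { s with cnt := List.replicate (P.eval s.y.length) true } S := by
  induction P using Polynomial.recOnHorner with
  | M0 =>
    refine ⟨skip, 1, fun I s S _ _ hc => Sub.congr sub_skip (by simp) ?_⟩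
    congr 1
    ext1 <;> simp [hc]
  | MC P a _ _ ih =>
    obtain ⟨p, R, h⟩ := ih
    refine ⟨p ;; iter (put .cnt true) a, R + C (2 * a + 1), fun I s S ht ha hc => ?_⟩
    refine ((h I s S ht ha hc).seq (iter_put_effect .cnt a)).congr (by simp) ?_
    simp [Data.get, Data.set, Nat.add_comm]
  | MX P _ ih =>
    obtain ⟨p, R, h⟩ := ih
    -- Multiplication by `X` is repeated addition: the value of `P` is parked on `aux`, and for each
    -- of its units `|y|` is added to the counter.
    refine ⟨p ;; shift .cnt .aux ;; each .aux (count .y .tmp .cnt),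
      R + (C 3 * P + 2 + (P * (C 7 * X + 6) + 2)), fun I s S ht ha hc => ?_⟩
    refine ((h I s S ht ha hc).seq ((shift_effect (i := .cnt) (j := .aux) (by decide)).seq
      (each_count_effect ht))).congr ?_ ?_
    · simp [Data.get, Data.set, ha]
    · simp [Data.get, Data.set, ha]

/-! ### Calling the machine -/

/-- Move the contents of a work stack to the input stack of `M`, in reverse order. -/
def toMachine (e : M.Γ M.k₀ ≃ Option Bool) (i : WorkStack) : MProg M :=
  move (work i) some (Sum.inr M.k₀) e.symm

theorem toMachine_effect (e : M.Γ M.k₀ ≃ Option Bool) (i : WorkStack) :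
    Effect (toMachine e i : MProg M) (3 * (s.get i).length + 2) I s S I (s.set i [])
      (update S M.k₀ ((s.get i).reverse.map (fun b => e.symm (some b)) ++ S M.k₀)) := by
  have := sub_move (z := idle M) (a := work i) (b := (Sum.inr M.k₀ : Stk M)) (by simp) some e.symm
    (stk I s S)
  rw [update_stk_work, update_stk_machine] at this
  refine this.congr le_rfl ?_
  simp [stk]

/-- Push a separator onto the input stack of `M`. -/
def separate (e : M.Γ M.k₀ ≃ Option Bool) : MProg M := pushC (Sum.inr M.k₀) (e.symm none) ;; skip

theorem separate_effect (e : M.Γ M.k₀ ≃ Option Bool) :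
    Effect (separate e : MProg M) 2 I s S I s (update S M.k₀ (e.symm none :: S M.k₀)) := by
  intro r
  rw [← update_stk_machine]
  exact runs_pushC.seq (sub_skip r)

/-- Take proofs from `p` and `q`, as long as the counters `aux` and `cnt`, and run `M` on the
reverse of `y` and these proofs. -/
noncomputable def call (e : M.Γ M.k₀ ≃ Option Bool) (o : Option Bool) : MProg M :=
  takeWork .cnt .q .tmp o ;; toMachine e .tmp ;; separate e ;;
    takeWork .aux .p .tmp o ;; toMachine e .tmp ;; separate e ;; toMachine e .y ;; sim

theorem length_takeOr_le {α β : Type} (f : α → β) (o : Option β) (n : ℕ) (l : List α) :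
    (takeOr f o n l).length ≤ n := by
  induction n generalizing l with
  | zero => simp [takeOr]
  | succ n ih =>
    cases l with
    | nil =>
      have := ih []
      cases o <;> simp [takeOr] <;> omega
    | cons x l => simpa [takeOr] using ih l

/-- A stack is filled from the bottom, so the word `x # π₁ # π₂` is written from its end. A proof
passes through `tmp` and is reversed twice; the string on `y` moves only once, and is therefore kept
in reverse. -/
theorem exists_call_effect (M : FinTM2) (e : M.Γ M.k₀ ≃ Option Bool) (o : Option Bool) :
    ∃ C : ℕ, ∀ (I : List (Option Bool)) (s : Data) (t : ℕ) (l' : List (M.Γ M.k₁)), s.tmp = [] →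
      Nonempty (TM2OutputsInTime M ((encTriple (s.y.reverse, takeOr id o s.aux.length s.p,
        takeOr id o s.cnt.length s.q)).map e.symm) (some l') t) →
      Effect (call e o) (8 * s.cnt.length + 8 * s.aux.length + 3 * s.y.length + C * t + 16) I s
        (fun _ => []) I { s with
          cnt := [], aux := [], y := [], p := s.p.drop s.aux.length,
          q := s.q.drop s.cnt.length } (update (fun _ => []) M.k₁ l') := by
  obtain ⟨C, hC⟩ := exists_sim_effect M
  refine ⟨C, fun I s t l' ht hM => ?_⟩
  have h := hC t _ l' hM I { s with
          cnt := [], aux := [], y := [], p := s.p.drop s.aux.length,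
          q := s.q.drop s.cnt.length }
  have h1 := length_takeOr_le id o s.aux.length s.p
  have h2 := length_takeOr_le id o s.cnt.length s.q
  have a1 := takeWork_effect (M := M) (I := I) (s := s) (S := fun _ => []) (k := .cnt) (i := .q)
    (j := .tmp) (by decide) (by decide) (by decide) o
  refine (a1.seq ((toMachine_effect e .tmp).seq ((separate_effect e).seq
    ((takeWork_effect (k := .aux) (i := .p) (j := .tmp) (by decide) (by decide) (by decide) o).seq
    ((toMachine_effect e .tmp).seq ((separate_effect e).seq ((toMachine_effect e .y).seq
    (t := C * t + 2) (S'' := stk I { s with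
          cnt := [], aux := [], y := [], p := s.p.drop s.aux.length,
          q := s.q.drop s.cnt.length } (update (fun _ => []) M.k₁ l')) ?_))))))).congr ?_ rfl
  · convert h using 2
    · simp [Data.set, Data.get, ht]
    · simp [Data.set, Data.get, ht, encTriple, Function.comp_def]
  · simp [Data.set, Data.get, ht]
    omega

/-- Push symbols from the output stack of `M` onto the work stack `j`, one for each symbol on the
counter `k`, and drop the other symbols. -/
def fetch (e : M.Γ M.k₁ ≃ Bool) (k j : WorkStack) : MProg M :=
  takeTo (work k) some (Sum.inr M.k₁) (fun a => some (e a)) (work j)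
    (fun b => (b.getD false : Bool)) none ;; clear (Sum.inr M.k₁) (fun a => some (e a))

/-- The output is cut while it is copied, and the rest is discarded, so that the stacks of `M` are
empty for the next call. The copy is reversed, as `call` expects of the string on `y`. -/
theorem fetch_effect (e : M.Γ M.k₁ ≃ Bool) {k j : WorkStack} (hkj : k ≠ j) (l : List Bool) :
    Effect (fetch e k j : MProg M) (5 * (s.get k).length + 3 * l.length + 4) I s
      (update (fun _ => []) M.k₁ (l.map e.symm)) I
      ((s.set k []).set j ((l.take (s.get k).length).reverse ++ s.get j)) fun _ => [] := by
  have h1 := sub_takeTo (z := idle M) (k := (work k : Stk M)) (a := Sum.inr M.k₁) (b := work j)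
    (by simp) (work_ne hkj) (by simp) some (fun a => some (e a)) (fun b => (b.getD false : Bool))
    none (stk I s (update (fun _ => []) M.k₁ (l.map e.symm)))
  have h2 := h1.seq (sub_clear (Sum.inr M.k₁) (fun a => some (e a)) _)
  rw [update_stk_work, update_stk_machine, update_stk_work, update_stk_machine] at h2
  refine h2.congr ?_ ?_
  · simp [stk]
    omega
  · simp [stk, takeOr_none, ← List.map_take, Function.comp_def]
end MProg

end SymAlt

namespace SymAlt

open Turing Function

/-- The binary expansion of `n + 1` has one digit more than `s_n`. This turns exponential time in
`|s_n|` into polynomial time in `n`. -/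
theorem two_pow_length_stdEnum_le (n : ℕ) : 2 ^ (stdEnum n).length ≤ n + 1 := by
  have h : (stdEnum n).length < Nat.size (n + 1) := by
    rw [← Nat.size_eq_bits_len, bits_succ_eq]
    simp [stdEnum]
  exact Nat.lt_size.1 h

theorem length_stdEnum_le (n : ℕ) : (stdEnum n).length ≤ n := by
  have h1 := two_pow_length_stdEnum_le n
  have h2 := Nat.lt_two_pow_self (n := (stdEnum n).length)
  omega

namespace MProg

open Prog

variable {M : FinTM2} {I : List (Option Bool)} {s : Data} {S : ∀ k, List (M.Γ k)}

/-! ### The standard enumeration -/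

/-- Move half of the counter `acc` to `tmp`, and flag on `x` whether the counter was odd. -/
def halve : MProg M :=
  each .acc (popR (work .acc) some ;; ite (fun r => r.isSome) (put .tmp true)
    (drop .x ;; put .x true))

/-- Symbols are popped in pairs, hence the induction in steps of two. A last odd symbol finds `acc`
empty at the second pop, and then the flag on `x` is replaced. -/
theorem halve_effect (m : ℕ) {l : List Bool} (hx : s.x = false :: l)
    (hm : s.acc = List.replicate m true) :
    Effect (halve : MProg M) (8 * m + 2) I s S I
      { s with
        x := m.bodd :: l, acc := [], tmp := List.replicate m.div2 true ++ s.tmp } S := by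
  induction m using Nat.twoStepInduction generalizing s with
  | zero =>
    refine (sub_forPop_nil (show stk I s S (work .acc) = [] from hm)).congr (by simp) ?_
    congr 1
    ext1 <;> simp [hx, hm]
  | one =>
    refine (sub_forPop_cons (a := true) (l := []) (r' := none) (s := 6) (t := 2)
      (S' := stk I { s with x := true :: l, acc := [] } S)
      (S'' := stk I { s with x := true :: l, acc := [] } S) hm ?_
      (sub_forPop_nil rfl)).congr (by simp) (by simp)
    rw [update_stk_work]
    refine (runs_popR_nil _ rfl).seq (t := 5) (Runs.ite_neg rfl ?_)
    refine (((drop_effect .x).seq (put_effect .x true)).congr le_rfl ?_) _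
    simp [Data.set, Data.get, hx]
  | more m ih _ =>
    have h1 := ih (s := { s with acc := List.replicate m true, tmp := true :: s.tmp }) hx rfl
    refine (sub_forPop_cons (a := true) (l := List.replicate (m + 1) true) (r' := none) (s := 4)
      (S' := stk I { s with acc := List.replicate m true, tmp := true :: s.tmp } S) hm ?_
      h1).congr (by omega) ?_
    · rw [update_stk_work]
      refine (runs_popR_cons (S := stk I (s.set .acc (List.replicate (m + 1) true)) S)
        (k := work .acc) (a := true) (l := List.replicate m true) _ rfl).seq (t := 3)
        (Runs.ite_pos rfl ?_)
      rw [update_stk_work]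
      exact put_effect .tmp true _
    · have hd : (m + 2).div2 = m.div2 + 1 := by
        rw [Nat.div2_val, Nat.div2_val]; omega
      have hb : (m + 2).bodd = m.bodd := by simp
      rw [hd, hb]
      simp [List.replicate_succ']

/-- Convert the number on the counter `acc` to binary, without the leading digit. -/
def toBinary : MProg M :=
  each .acc (put .acc true ;; put .x false ;; halve ;; shift .tmp .acc) ;; drop .x

/-- Each round pushes the lowest digit onto `x`, so the leading `1` ends on top, where `toBinary`
drops it. The loop test consumes a symbol of `acc`, which the body first puts back. Halving makes
the costs a geometric sum, so the bound is linear. -/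
theorem each_halve_effect (m : ℕ) (ht : s.tmp = []) (hm : s.acc = List.replicate m true) :
    Effect (each .acc (put .acc true ;; put .x false ;; halve ;; shift .tmp .acc) : MProg M)
      (40 * m + 2) I s S I { s with x := (Nat.bits m).reverse ++ s.x, acc := [] } S := by
  induction m using Nat.strong_induction_on generalizing s with
  | _ m ih =>
    obtain rfl | ⟨k, rfl⟩ : m = 0 ∨ ∃ k, m = k + 1 := by
      cases m <;> simp
    · refine (sub_forPop_nil (show stk I s S (work .acc) = [] from hm)).congr (by simp) ?_
      congr 1
      ext1 <;> simp [hm]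
    · have hlt : (k + 1).div2 < k + 1 := by rw [Nat.div2_val]; omega
      have h1 := ih (k + 1).div2 hlt
        (s := { s with x := (k + 1).bodd :: s.x, acc := List.replicate (k + 1).div2 true }) ht rfl
      refine (sub_forPop_cons (a := true) (l := List.replicate k true) (r' := none)
        (s := 2 + (2 + (8 * (k + 1) + 2 + (3 * (k + 1).div2 + 2))))
        (S' := stk I { s with x := (k + 1).bodd :: s.x, acc := List.replicate (k + 1).div2 true } S)
        hm ?_ h1).congr ?_ ?_
      · rw [update_stk_work]
        refine (((put_effect .acc true).seq ((put_effect .x false).seq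
          ((halve_effect (l := s.x) (k + 1) ?_ ?_).seq (shift_effect (by decide))))).congr
          ?_ ?_) _
        · simp [Data.set, Data.get]
        · simp [Data.set, Data.get, List.replicate_succ]
        · simp [Data.set, Data.get, ht]
        · simp [Data.set, Data.get, ht]
      · rw [Nat.div2_val]
        omega
      · have hb : Nat.bits (k + 1) = (k + 1).bodd :: Nat.bits (k + 1).div2 := by
          conv_lhs => rw [← Nat.bit_bodd_div2 (k + 1)]
          refine Nat.bits_append_bit _ _ fun h => ?_
          rcases k with _ | k
          · rfl
          · rw [Nat.div2_val] at h; omega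
        rw [hb]
        simp

theorem toBinary_effect (n : ℕ) (ht : s.tmp = []) (hx : s.x = [])
    (hn : s.acc = List.replicate (n + 1) true) :
    Effect (toBinary : MProg M) (40 * (n + 1) + 4) I s S I
      { s with x := stdEnum n, acc := [] } S := by
  refine ((each_halve_effect (n + 1) ht hn).seq (drop_effect .x)).congr le_rfl ?_
  simp only [Data.set, Data.get, hx, List.append_nil, stdEnum, List.tail_reverse]

/-- Multiply the counter `cnt` by `2 ^ c` for each symbol on `x`, and move these symbols
to `y`. -/
def expand (c : ℕ) : MProg M :=
  each .x (pushR (work .y) (fun b => (b.getD false : Bool)) ;; iter (double .cnt .tmp) c)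

theorem expand_effect (c : ℕ) {x : List Bool} {m B : ℕ} (hB : 2 ^ (c * x.length) * m ≤ B)
    (hx : s.x = x) (ht : s.tmp = []) (hm : s.cnt = List.replicate m true) :
    Effect (expand c : MProg M) (x.length * (c * (12 * B + 4) + 4) + 2) I s S I
      { s with
        x := [], y := x.reverse ++ s.y,
        cnt := List.replicate (2 ^ (c * x.length) * m) true } S := by
  induction x generalizing m s with
  | nil =>
    refine (sub_forPop_nil (show stk I s S (work .x) = [] from hx)).congr (by simp) ?_
    congr 1
    ext1 <;> simp [hx, hm]
  | cons b x ih =>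
    have hpow : 2 ^ (c * x.length) * (2 ^ c * m) = 2 ^ (c * (b :: x).length) * m := by
      rw [List.length_cons, Nat.mul_succ, pow_add, mul_assoc]
    have h1 := ih (m := 2 ^ c * m)
      (s := { s with x := x, y := b :: s.y, cnt := List.replicate (2 ^ c * m) true })
      (hpow ▸ hB) rfl ht rfl
    have hmB : 2 ^ c * m ≤ B :=
      (Nat.le_mul_of_pos_left _ (by positivity)).trans (hpow.le.trans hB)
    refine (sub_forPop_cons (a := b) (l := x) (r' := none) (s := 1 + (c * (12 * B + 4) + 1))
      (S' := stk I { s with x := x, y := b :: s.y, cnt := List.replicate (2 ^ c * m) true } S)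
      hx ?_ h1).congr ?_ ?_
    · rw [update_stk_work]
      refine (runs_pushR _).seq ?_
      rw [update_stk_work]
      exact iter_double_effect (s := { s with x := x, y := b :: s.y }) c hmB ht hm _
    · rw [List.length_cons, Nat.add_mul x.length 1, Nat.one_mul]
      omega
    · rw [hpow]
      simp

/-! ### Input and output -/

/-- Push the output of `M` onto the output stack. -/
def output (e : M.Γ M.k₁ ≃ Bool) : MProg M :=
  move (Sum.inr M.k₁) (fun a => some (e a)) (work .out) (fun b => (b.getD false : Bool))

theorem output_effect (e : M.Γ M.k₁ ≃ Bool) (b : Bool) :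
    Effect (output e : MProg M) 5 I s (update (fun _ => []) M.k₁ [e.symm b]) I
      (s.set .out (b :: s.out)) fun _ => [] := by
  have h1 := sub_move (z := idle M) (a := (Sum.inr M.k₁ : Stk M)) (b := work .out) (by simp)
    (fun a => some (e a)) (fun b => (b.getD false : Bool))
    (stk I s (update (fun _ => []) M.k₁ [e.symm b]))
  rw [update_stk_machine, update_stk_work] at h1
  refine h1.congr ?_ ?_
  · simp [stk]
  · simp [stk, Data.get]

/-- Read the three parts of the input onto the stacks `j`, `p` and `q`, the first one in reverse
order. -/
def readInput (j : WorkStack) : MProg M :=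
  readBlock j ;; (readBlock .tmp ;; shift .tmp .p) ;; readBlock .tmp ;; shift .tmp .q

theorem readInput_effect {j : WorkStack} (hj : j = .fuel ∨ j = .y) (x π₁ π₂ : List Bool) :
    Effect (readInput j : MProg M) (3 * x.length + 6 * π₁.length + 6 * π₂.length + 13)
      (encTriple (x, π₁, π₂)) {} S [] (({ p := π₁, q := π₂ } : Data).set j x.reverse) S := by
  have h1 := readBlock_effect (M := M) (s := {}) (S := S) j x
    (none :: (π₁.map some ++ none :: π₂.map some)) rfl
  have h2 := readBlock_effect (M := M) (s := (Data.set {} j x.reverse)) (S := S) .tmp π₁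
    (none :: π₂.map some) rfl
  have h3 := readBlock_effect (M := M) (s := (({ p := π₁ } : Data).set j x.reverse)) (S := S)
    .tmp π₂ [] rfl
  rw [List.append_nil] at h3
  rcases hj with rfl | rfl
  all_goals
    refine ((h1.congr (S'' := stk _ (Data.set {} _ x.reverse) S) le_rfl ?_).seq ((h2.seq
      (shift_effect (i := .tmp) (j := .p) (by decide))).congr le_rfl ?_ |>.seq (h3.seq
      (shift_effect (i := .tmp) (j := .q) (by decide))))).congr
      ?_ ?_
    · simp [Data.set, Data.get]
    · simp [Data.set, Data.get]
    · simp [Data.set, Data.get]; omega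
    · simp [Data.set, Data.get]

theorem update_nil_input (l : List (Option Bool)) :
    (update (fun _ => []) (Sum.inl none) l : ∀ k, List (Alph M k)) = stk l {} fun _ => [] := by
  funext k
  rcases k with (_ | i) | k
  · rfl
  · cases i <;> rfl
  · rfl

theorem update_nil_output (l : List Bool) :
    (update (fun _ => []) (work .out) l : ∀ k, List (Alph M k)) =
      stk [] { out := l } fun _ => [] := by
  funext k
  rcases k with (_ | i) | k
  · rfl
  · cases i <;> rfl
  · rfl

/-- The machine that executes a program, from the input stack to the output stack. -/
noncomputable def toAux (p : MProg M) : TM2ComputableAux (Option Bool) Bool :=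
  letI := M.ΛFin
  letI := M.σFin
  letI := M.kFin
  { tm := p.toFinTM2 (Sum.inl none) (work .out) (none, idle M)
    inputAlphabet := Equiv.refl _
    outputAlphabet := Equiv.refl _ }

theorem toAux_outputsInTime {p : MProg M} {t u : ℕ} {l : List (Option Bool)} {l' : List Bool}
    (h : Effect p t l {} (fun _ => []) [] { out := l' } fun _ => []) (htu : t < u) :
    Nonempty (TM2OutputsInTime p.toAux.tm (l.map p.toAux.inputAlphabet.symm)
      (some (l'.map p.toAux.outputAlphabet.symm)) u) := by
  let _ := M.ΛFin
  let _ := M.σFin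
  let _ := M.kFin
  have h1 := h none
  rw [← update_nil_input, ← update_nil_output] at h1
  have h2 := Runs.outputsInTime h1 htu
  have e1 : l.map p.toAux.inputAlphabet.symm = l := List.map_id l
  have e2 : l'.map p.toAux.outputAlphabet.symm = l' := List.map_id l'
  rw [e1, e2]
  exact h2

end MProg

end SymAlt

namespace SymAlt

open Turing Function

namespace MProg

open Prog

variable {M : FinTM2}

/-! ### From a verifier for a language to a constructor -/

/-- Compute `y ++ [b]`, where `b` is the output of `M` on the `|y|`-th string `x` and the given
proofs, which are brought to the length `2 ^ (c * |x|)`. -/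
noncomputable def appendBit (e : M.Γ M.k₀ ≃ Option Bool) (e' : M.Γ M.k₁ ≃ Bool) (c : ℕ) : MProg M :=
  readInput .fuel ;; count .fuel .tmp .acc ;; put .acc true ;; toBinary ;; put .cnt true ;;
    expand c ;; count .cnt .tmp .aux ;; call e (some false) ;; output e' ;; shift .fuel .out ;;
    erase .p ;; erase .q

/-- Polynomial time is demanded for proofs of every length, but the running time of `M` is known
only for proofs of length exactly `T`; `takeD` pads or cuts them. A reversed copy of `y` waits on
`fuel`, and is moved on top of the output bit at the end. -/
theorem exists_appendBit_effect (e : M.Γ M.k₀ ≃ Option Bool) (e' : M.Γ M.k₁ ≃ Bool) (c : ℕ) :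
    ∃ C : ℕ, ∀ (y π₁ π₂ x : List Bool) (T t : ℕ) (b : Bool), stdEnum y.length = x →
      2 ^ (c * x.length) = T →
      Nonempty (TM2OutputsInTime M ((encTriple (x, π₁.takeD T false, π₂.takeD T false)).map e.symm)
        (some [e'.symm b]) t) →
      Effect (appendBit e e' c) (100 * (y.length + π₁.length + π₂.length + 1) +
        x.length * (c * (12 * T + 4) + 4) + 30 * T + C * t) (encTriple (y, π₁, π₂)) {}
        (fun _ => []) [] { out := y ++ [b] } fun _ => [] := by
  obtain ⟨C, hC⟩ := exists_call_effect M e (some false)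
  refine ⟨C, fun y π₁ π₂ x T t b hx hT hM => ?_⟩
  have h1 := readInput_effect (M := M) (S := fun _ => []) (j := .fuel) (Or.inl rfl) y π₁ π₂
  have h2 : Effect (count .fuel .tmp .acc : MProg M) (7 * y.length + 4) [] _ (fun _ => []) []
      { p := π₁, q := π₂, fuel := y.reverse, acc := List.replicate y.length true } fun _ => [] :=
    (count_effect (s := { p := π₁, q := π₂, fuel := y.reverse }) (by decide) (by decide)
      (by decide) rfl).congr (by simp [Data.get]) (by simp [Data.get, Data.set])
  have h3 : Effect (put .acc true : MProg M) 2 [] _ (fun _ => []) []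
      { p := π₁, q := π₂, fuel := y.reverse, acc := List.replicate (y.length + 1) true }
      fun _ => [] :=
    put_effect (s := { p := π₁, q := π₂, fuel := y.reverse, acc := List.replicate y.length true })
      .acc true
  have h4 := toBinary_effect (M := M) (I := []) (S := fun _ => []) (s :=
      { p := π₁, q := π₂, fuel := y.reverse, acc := List.replicate (y.length + 1) true })
      y.length rfl rfl rfl
  rw [hx] at h4
  have h5 : Effect (put .cnt true : MProg M) 2 [] _ (fun _ => []) []
      { p := π₁, q := π₂, fuel := y.reverse, x := x, cnt := List.replicate 1 true } fun _ => [] :=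
    put_effect (s := { p := π₁, q := π₂, fuel := y.reverse, x := x }) .cnt true
  have h6 := expand_effect (M := M) (I := []) (S := fun _ => []) (s :=
      { p := π₁, q := π₂, fuel := y.reverse, x := x, cnt := List.replicate 1 true })
      c (x := x) (m := 1) (B := T)
    (by rw [hT, mul_one]) rfl rfl rfl
  rw [hT, mul_one, List.append_nil] at h6
  have h7 : Effect (count .cnt .tmp .aux : MProg M) (7 * T + 4) [] _ (fun _ => []) []
      { p := π₁, q := π₂, fuel := y.reverse, y := x.reverse, cnt := List.replicate T true,
        aux := List.replicate T true } fun _ => [] :=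
    (count_effect (s :=
        { p := π₁, q := π₂, fuel := y.reverse, y := x.reverse, cnt := List.replicate T true })
        (by decide) (by decide)
      (by decide) rfl).congr (by simp [Data.get]) (by simp [Data.get, Data.set])
  have h8 := hC []
      { p := π₁, q := π₂, fuel := y.reverse, y := x.reverse, cnt := List.replicate T true,
        aux := List.replicate T true } t [e'.symm b] rfl
    (by simpa [takeOr_some] using hM)
  have h9 := output_effect (M := M) (I := []) (s :=
      { p := π₁.drop (List.replicate T true).length,
        q := π₂.drop (List.replicate T true).length, fuel := y.reverse }) e' b
  have h10 := shift_effect (M := M) (I := []) (S := fun _ => []) (s :=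
      { p := π₁.drop (List.replicate T true).length,
        q := π₂.drop (List.replicate T true).length, fuel := y.reverse, out := [b] })
      (i := .fuel) (j := .out) (by decide)
  have h11 := erase_effect (M := M) (I := []) (S := fun _ => []) (s :=
      { p := π₁.drop (List.replicate T true).length,
        q := π₂.drop (List.replicate T true).length, out := y.reverse.reverse ++ [b] }) .p
  have h12 := erase_effect (M := M) (I := []) (S := fun _ => []) (s :=
      { q := π₂.drop (List.replicate T true).length, out := y.reverse.reverse ++ [b] }) .q
  refine (h1.seq (h2.seq (h3.seq (h4.seq (h5.seq (h6.seq (h7.seq (h8.seq (h9.seq (h10.seq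
    (h11.seq h12))))))))))).congr ?_ ?_
  · have := length_stdEnum_le y.length
    rw [hx] at this
    simp only [Data.get, List.length_replicate, List.length_reverse, List.length_drop]
    omega
  · simp [Data.set]

end MProg

/-- A bound on the tail of a sequence is, up to a constant, a bound on the sequence. -/
theorem exists_forall_le_of_isBigO {t T : ℕ → ℕ} (hT : ∀ n, 0 < T n)
    (h : Asymptotics.IsBigO Filter.atTop (fun n => (t n : ℝ)) (fun n => (T n : ℝ))) :
    ∃ D : ℕ, ∀ n, t n ≤ D * T n := by
  obtain ⟨c, hc⟩ := h.bound
  obtain ⟨n₀, hn₀⟩ := Filter.eventually_atTop.1 hc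
  obtain ⟨k, hk⟩ := exists_nat_ge c
  -- `k` serves the tail and the sum the finitely many exceptions, where `T n ≥ 1` is used.
  refine ⟨k + ∑ i ∈ Finset.range n₀, t i, fun n => ?_⟩
  rcases le_or_gt n₀ n with hn | hn
  · have h1 := hn₀ n hn
    simp only [Real.norm_natCast] at h1
    have h2 : (t n : ℝ) ≤ (k * T n : ℕ) := by
      push_cast
      exact h1.trans (mul_le_mul_of_nonneg_right hk (Nat.cast_nonneg _))
    exact (Nat.cast_le.1 h2).trans (Nat.mul_le_mul_right _ (Nat.le_add_right _ _))
  · have h1 : t n ≤ ∑ i ∈ Finset.range n₀, t i :=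
      Finset.single_le_sum (f := t) (fun _ _ => Nat.zero_le _) (Finset.mem_range.2 hn)
    calc t n ≤ k + ∑ i ∈ Finset.range n₀, t i := by omega
      _ ≤ _ := Nat.le_mul_of_pos_right _ (hT n)

/-! ### The inclusion of `S2E` in the result class -/

theorem length_encTriple (x π₁ π₂ : List Bool) :
    (encTriple (x, π₁, π₂)).length = x.length + π₁.length + π₂.length + 2 := by
  simp [encTriple]
  omega

theorem takeD_eq_take {α : Type} {n : ℕ} {l : List α} (h : n ≤ l.length) (a : α) :
    l.takeD n a = l.take n := by
  induction n generalizing l with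
  | zero => simp
  | succ n ih =>
    cases l with
    | nil => simp at h
    | cons b l => simp [ih (Nat.le_of_succ_le_succ h)]

theorem isResult_append_chi (L : Language Bool) :
    IsResult (fun y => y ++ [chi L (stdEnum y.length)]) (charSeq L) := by
  intro n
  induction n with
  | zero => intro i hi; simp at hi
  | succ n ih =>
    rw [iterate_succ_apply']
    intro i hi
    rw [List.length_append, List.length_singleton] at hi
    rcases Nat.lt_succ_iff_lt_or_eq.1 hi with h | h
    · rw [List.getElem_append_left h]
      exact ih i h
    · subst h
      simp [charSeq]

open Polynomial in
/-- The function that appends the next bit of the characteristic sequence of a language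
in `S₂^E` is in `FS₂^P`. -/
theorem append_chi_mem_FS2P {L : Language Bool} {c : ℕ} (hL : L ∈ S2TIME fun n => 2 ^ (c * n)) :
    (fun y => y ++ [chi L (stdEnum y.length)]) ∈ FS2P := by
  obtain ⟨V, ⟨M, t, ht, hM⟩, hV⟩ := hL
  obtain ⟨D, hD⟩ := exists_forall_le_of_isBigO (fun n => by positivity) ht
  obtain ⟨K, hK⟩ := MProg.exists_appendBit_effect M.inputAlphabet M.outputAlphabet c
  let T : List Bool → ℕ := fun y => 2 ^ (c * (stdEnum y.length).length)
  have hT : ∀ y : List Bool, T y ≤ (y.length + 1) ^ c := fun y => by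
    show 2 ^ (c * (stdEnum y.length).length) ≤ _
    rw [mul_comm, pow_mul]
    exact Nat.pow_le_pow_left (two_pow_length_stdEnum_le _) c
  -- `T y` need not be a polynomial in `|y|`, so the proof length is a polynomial bound on it, and
  -- the verifier reads the first `T y` bits only.
  let A : FS2PAlgorithm :=
    { ℓ := (X + 1) ^ c
      V := fun y π₁ π₂ =>
        y ++ [V (stdEnum y.length) (π₁.takeD (T y) false) (π₂.takeD (T y) false)]
      polyTime := by
        refine ⟨⟨(MProg.appendBit M.inputAlphabet M.outputAlphabet c).toAux,
          C 100 * X + X * (C c * (C 12 * X ^ c + C 4) + C 4) + C 30 * X ^ c +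
            C (K * D) * X ^ c + 1, fun ⟨y, π₁, π₂⟩ => Nonempty.some ?_⟩⟩
        have h1 := hM (stdEnum y.length) (π₁.takeD (T y) false) (π₂.takeD (T y) false)
          (List.takeD_length _ _ _) (List.takeD_length _ _ _)
        have h2 := hK y π₁ π₂ _ (T y) _ _ rfl rfl h1
        refine MProg.toAux_outputsInTime h2 ?_
        have h3 : (encTriple (y, π₁, π₂)).length = y.length + π₁.length + π₂.length + 2 :=
          length_encTriple _ _ _
        have h4 : T y ≤ (y.length + π₁.length + π₂.length + 2) ^ c :=
          (hT y).trans (Nat.pow_le_pow_left (by omega) c)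
        have h5 : t (stdEnum y.length).length ≤ D * T y := hD _
        have h6 : (stdEnum y.length).length ≤ y.length + π₁.length + π₂.length := by
          have := length_stdEnum_le y.length
          omega
        simp only [eval_add, eval_mul, eval_C, eval_X, eval_pow, eval_one, h3]
        generalize y.length + π₁.length + π₂.length = l at *
        generalize (l + 2) ^ c = B at *
        have h7 : K * t (stdEnum y.length).length ≤ K * D * B := by
          rw [mul_assoc]
          exact Nat.mul_le_mul_left _ (h5.trans (Nat.mul_le_mul_left _ h4))
        have h8 : (stdEnum y.length).length * (c * (12 * T y + 4) + 4) ≤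
            (l + 2) * (c * (12 * B + 4) + 4) := by
          refine Nat.mul_le_mul (by omega) (Nat.add_le_add_right (Nat.mul_le_mul_left _ ?_) _)
          omega
        omega }
  refine ⟨A, fun y => ?_⟩
  have hl : A.ℓ.eval y.length = (y.length + 1) ^ c := by simp [A]
  -- A winning proof for `V` can be prolonged, since the verifier ignores all bits beyond `T y`. The
  -- opponent's proof is cut in the same way, to one that the winning proof beats.
  have key : ∀ π : List Bool, π.length = T y →
      ∃ π' : List Bool, π'.length = A.ℓ.eval y.length ∧ π'.takeD (T y) false = π := by
    intro π hπ
    refine ⟨π ++ List.replicate ((y.length + 1) ^ c - T y) false, ?_, ?_⟩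
    · have := hT y
      rw [List.length_append, List.length_replicate, hl]
      omega
    · rw [takeD_eq_take (by simp [hπ]), ← hπ, List.take_left]
  obtain ⟨⟨π₁, hl₁, h₁⟩, π₂, hl₂, h₂⟩ := hV (stdEnum y.length)
  constructor
  · obtain ⟨π', hπ', he⟩ := key π₁ hl₁
    refine ⟨π', hπ', fun π _ => ?_⟩
    show y ++ [V _ (π'.takeD (T y) false) _] = _
    rw [he, h₁ _ (List.takeD_length _ _ _)]
  · obtain ⟨π', hπ', he⟩ := key π₂ hl₂
    refine ⟨π', hπ', fun π _ => ?_⟩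
    show y ++ [V _ _ (π'.takeD (T y) false)] = _
    rw [he, h₂ _ (List.takeD_length _ _ _)]

theorem charSeq_mem_resultClass {L : Language Bool} (hL : L ∈ S2E) :
    charSeq L ∈ resultClass FS2P := by
  simp only [S2E, Set.mem_iUnion] at hL
  obtain ⟨c, _, hc⟩ := hL
  exact ⟨_, append_chi_mem_FS2P hc, fun x => ⟨List.prefix_append _ _, by simp⟩,
    isResult_append_chi L⟩

end SymAlt

namespace SymAlt

open Turing Function

/-! ### Polynomial bounds -/

theorem eval_mono_nat (P : Polynomial ℕ) {a b : ℕ} (h : a ≤ b) : P.eval a ≤ P.eval b := by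
  rw [Polynomial.eval_eq_sum_range, Polynomial.eval_eq_sum_range]
  gcongr

/-- For a monomial this rests on `a ≤ 2 ^ (a * m)` and `m + 1 ≤ 2 * m`. Both may fail at `m = 0`,
where the right side is `1` for every `k`. -/
theorem exists_eval_two_pow_le (P : Polynomial ℕ) :
    ∃ k : ℕ, ∀ m, 1 ≤ m → P.eval (2 ^ (m + 1)) ≤ 2 ^ (k * m) := by
  induction P using Polynomial.induction_on' with
  | add P Q hP hQ =>
    obtain ⟨k, hk⟩ := hP
    obtain ⟨l, hl⟩ := hQ
    refine ⟨k + l + 1, fun m hm => ?_⟩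
    have h1 : 2 ^ (k * m) ≤ 2 ^ ((k + l) * m) :=
      Nat.pow_le_pow_right (by norm_num) (by gcongr; omega)
    have h2 : 2 ^ (l * m) ≤ 2 ^ ((k + l) * m) :=
      Nat.pow_le_pow_right (by norm_num) (by gcongr; omega)
    calc (P + Q).eval (2 ^ (m + 1)) ≤ 2 ^ (k * m) + 2 ^ (l * m) := by
          rw [Polynomial.eval_add]
          exact Nat.add_le_add (hk m hm) (hl m hm)
      _ ≤ 2 ^ ((k + l) * m + 1) := by rw [pow_succ]; omega
      _ ≤ _ := Nat.pow_le_pow_right (by norm_num) (by rw [Nat.add_mul (k + l) 1]; omega)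
  | monomial d a =>
    refine ⟨a + 2 * d, fun m hm => ?_⟩
    have h1 : a ≤ 2 ^ (a * m) := (Nat.lt_two_pow_self (n := a)).le.trans
      (Nat.pow_le_pow_right (by norm_num) (Nat.le_mul_of_pos_right a hm))
    have h2 : (2 ^ (m + 1)) ^ d ≤ 2 ^ (2 * d * m) := by
      rw [← pow_mul]
      refine Nat.pow_le_pow_right (by norm_num) ?_
      calc (m + 1) * d ≤ (2 * m) * d := by gcongr; omega
        _ = 2 * d * m := by ring
    rw [Polynomial.eval_monomial, Nat.add_mul a, pow_add 2 (a * m)]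
    exact Nat.mul_le_mul h1 h2

theorem foldr_bit_bits (n : ℕ) : (Nat.bits n).foldr Nat.bit 0 = n := by
  induction n using Nat.binaryRec' with
  | zero => simp
  | bit b n h ih => rw [Nat.bits_append_bit _ _ h, List.foldr_cons, ih]

/-- The initial value `1` restores the leading digit that `stdEnum` removes. -/
theorem binVal_stdEnum (n : ℕ) : MProg.binVal 1 (stdEnum n) = n + 1 := by
  have h := foldr_bit_bits (n + 1)
  rw [bits_succ_eq, List.foldr_append] at h
  have hf : (fun (b : Bool) a => 2 * a + b.toNat) = Nat.bit := by
    funext b a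
    rw [Nat.bit_val]
  rw [MProg.binVal, stdEnum, List.foldl_reverse, hf]
  exact h

theorem binVal_lt (m : ℕ) (x : List Bool) : MProg.binVal m x < (m + 1) * 2 ^ x.length := by
  induction x generalizing m with
  | nil => simp [MProg.binVal]
  | cons b x ih =>
    refine (ih (2 * m + b.toNat)).trans_le ?_
    rw [List.length_cons, pow_succ, mul_comm _ 2, ← mul_assoc]
    gcongr
    have := b.toNat_le
    omega

namespace MProg

open Prog

variable {M : FinTM2} {I : List (Option Bool)} {s : Data} {S : ∀ k, List (M.Γ k)}

/-- Only a push lengthens a stack, and `stmtTime` counts at least every push on the path taken. -/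
theorem length_stepAux_le (q : TM2.Stmt M.Γ M.Λ M.σ) (v : M.σ) (S : ∀ k, List (M.Γ k)) (k : M.K) :
    ((TM2.stepAux q v S).stk k).length ≤ (S k).length + stmtTime q := by
  induction q generalizing v S with
  | push j f q ih =>
    refine (ih v _).trans ?_
    by_cases h : k = j
    · subst h; simp [stmtTime]; omega
    · simp [h, stmtTime]
  | peek j f q ih => exact (ih _ S).trans (by simp [stmtTime])
  | pop j f q ih =>
    refine (ih _ _).trans ?_
    by_cases h : k = j
    · subst h; simp [stmtTime]; omega
    · simp [h, stmtTime]
  | load f q ih => exact (ih _ S).trans (by simp [stmtTime])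
  | branch f q₁ q₂ ih₁ ih₂ =>
    have h1 := ih₁ v S
    have h2 := ih₂ v S
    rw [TM2.stepAux, stmtTime]
    cases f v
    · simp only [cond_false]; omega
    · simp only [cond_true]; omega
  | goto f => simp [TM2.stepAux]
  | halt => simp [TM2.stepAux]

/-- The output of a machine is at most linear in its running time. -/
theorem exists_length_output_le (M : FinTM2) : ∃ C : ℕ, ∀ (t : ℕ) (l : List (M.Γ M.k₀))
    (l' : List (M.Γ M.k₁)), Nonempty (TM2OutputsInTime M l (some l') t) →
      l'.length ≤ l.length + C * t := by
  obtain ⟨C, hC⟩ := exists_stmtTime_le M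
  refine ⟨C, ?_⟩
  rintro t l l' ⟨⟨⟨n, hn⟩, hnt⟩⟩
  have key : ∀ (n : ℕ) (c c' : TM2.Cfg M.Γ M.Λ M.σ),
      (flip bind (TM2.step M.m))^[n] (some c) = some c' →
      (c'.stk M.k₁).length ≤ (c.stk M.k₁).length + C * n := by
    intro n
    induction n with
    | zero =>
      intro c c' h
      obtain rfl : c = c' := by simpa using h
      simp
    | succ n ih =>
      rintro ⟨_ | l, v, T⟩ c' h
      · rw [iterate_succ_apply] at h
        have h0 : ∀ n, (flip bind (TM2.step M.m))^[n] none = none := fun n =>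
          iterate_fixed rfl n
        exact absurd ((h0 n).symm.trans h) (by simp)
      · have h1 := ih (TM2.stepAux (M.m l) v T) c' (by rwa [iterate_succ_apply] at h)
        have h2 := length_stepAux_le (M.m l) v T M.k₁
        have h3 := hC l
        rw [Nat.mul_succ]
        simp only at *
        omega
  rw [initList_eq, Option.map_some, haltList_eq] at hn
  have h1 := key n _ _ hn
  have h2 : C * n ≤ C * t := Nat.mul_le_mul_left _ hnt
  have h3 : (update (fun _ => []) M.k₀ l M.k₁ : List (M.Γ M.k₁)).length ≤ l.length := by
    by_cases h : M.k₁ = M.k₀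
    · generalize M.k₁ = k at h
      subst h
      simp
    · simp [h]
  simp only [update_self] at h1
  omega

/-! ### From a constructor to a verifier for a language -/

/-- Push fixed bits onto a work stack. -/
def putList (i : WorkStack) : List Bool → MProg M
  | [] => skip
  | b :: l => putList i l ;; put i b

theorem putList_effect (i : WorkStack) (l : List Bool) :
    Effect (putList i l : MProg M) (2 * l.length + 1) I s S I (s.set i (l ++ s.get i)) S := by
  induction l with
  | nil =>
    refine Sub.congr sub_skip le_rfl ?_
    congr 1
    apply Data.get_injective
    simp [Data.get_set]
  | cons b l ih =>
    refine (ih.seq (put_effect i b)).congr (by simp; omega) ?_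
    congr 1
    apply Data.get_injective
    simp [Data.get_set]

/-- Output the symbol on top of the work stack `y`. -/
def outputTop : MProg M :=
  popR (work .y) some ;; pushR (work .out) (fun b => (b.getD false : Bool)) ;; skip

theorem outputTop_effect :
    Effect (outputTop : MProg M) 3 I s S I
      { s with out := s.y.headD false :: s.out, y := s.y.tail } S := by
  intro r
  have h1 := (Exec.pop (Γ := Alph M) (work .y)
    (fun (v : Reg × M.σ × Option M.Λ) a => (a.map some, v.2)) (r, idle M) (stk I s S)).runs
  refine h1.seq (t := 2) ?_
  rw [update_stk_work]
  have h2 := (Exec.push (Γ := Alph M) (work .out)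
    (fun (v : Reg × M.σ × Option M.Λ) => ((v.1.getD none).getD false : Bool))
    ((s.y.head?).map some, idle M) (stk I (s.set .y s.y.tail) S)).runs
  refine h2.seq (t := 1) ?_
  rw [update_stk_work]
  refine sub_skip.congr le_rfl ?_ _
  cases s.y <;> simp [Data.set, Data.get, stk]

/-- The next bits of the proofs, and the string that a verifier computes from them. -/
def verifyStep (V : List Bool → List Bool → List Bool → List Bool) (ℓ : ℕ → ℕ) (n : ℕ)
    (c : List Bool × List Bool × List Bool) : List Bool × List Bool × List Bool :=
  ((V c.1 (c.2.1.take (ℓ c.1.length)) (c.2.2.take (ℓ c.1.length))).take n,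
    c.2.1.drop (ℓ c.1.length), c.2.2.drop (ℓ c.1.length))

/-- Replace the string on `y` by the output of `M` on this string and the next bits of the
proofs, truncated to the length of the counter `acc`; `p` computes the length of the proofs. -/
noncomputable def round (p : MProg M) (e : M.Γ M.k₀ ≃ Option Bool) (e' : M.Γ M.k₁ ≃ Bool) :
    MProg M :=
  p ;; count .cnt .tmp .aux ;; call e none ;; count .acc .tmp .cnt ;; fetch e' .cnt .y

open Polynomial in
-- Truncation keeps the current string within length `n`, so monotonicity bounds proof lengths and
-- running times in terms of `n` alone. All of the output of `M` has to be removed from its stack,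
-- which is why `exists_length_output_le` is needed.
theorem exists_round_effect (A : FS2PAlgorithm) :
    ∃ (M : FinTM2) (p : MProg M) (G : ℕ[X]),
      ∀ (n : ℕ) (c : List Bool × List Bool × List Bool) (s : Data), c.1.length ≤ n →
        s.acc = List.replicate n true → s.tmp = [] → s.aux = [] → s.cnt = [] →
        Effect p (G.eval n) [] { s with y := c.1.reverse, p := c.2.1, q := c.2.2 } (fun _ => []) []
          { s with
            y := (verifyStep A.V A.ℓ.eval n c).1.reverse
            p := (verifyStep A.V A.ℓ.eval n c).2.1
            q := (verifyStep A.V A.ℓ.eval n c).2.2 } fun _ => [] := by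
  obtain ⟨⟨⟨M, e, e'⟩, time, hA⟩⟩ := A.polyTime
  obtain ⟨p, R, hR⟩ := exists_evalPolynomial M A.ℓ
  obtain ⟨K, hK⟩ := exists_call_effect M e none
  obtain ⟨K', hK'⟩ := exists_length_output_le M
  refine ⟨M, round p e e', R + 23 * A.ℓ + 15 * X + C K * time.comp (X + 2 * A.ℓ + 2) +
    3 * ((X + 2 * A.ℓ + 2) + C K' * time.comp (X + 2 * A.ℓ + 2)) + 40, ?_⟩
  rintro n ⟨Y, P, Q⟩ s hY hn ht ha hc
  simp only at hY
  have h1 := hR [] { s with y := Y.reverse, p := P, q := Q } (fun _ => []) ht ha hc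
  simp only [List.length_reverse] at h1
  set k := A.ℓ.eval Y.length with hk
  have h2 : Effect (count .cnt .tmp .aux : MProg M) (7 * k + 4) [] _ (fun _ => []) []
      { s with
        y := Y.reverse, p := P, q := Q, cnt := List.replicate k true,
        aux := List.replicate k true } fun _ => [] :=
    (count_effect (i := .cnt) (t := .tmp) (j := .aux)
      (s := { s with y := Y.reverse, p := P, q := Q, cnt := List.replicate k true })
      (by decide) (by decide) (by decide) ht).congr (by simp [Data.get])
      (by simp [Data.get, Data.set, ha])
  have hM : Nonempty (TM2OutputsInTime M ((encTriple (Y, P.take k, Q.take k)).map e.symm)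
      (some ((A.V Y (P.take k) (Q.take k)).map e'.symm))
      (time.eval (encTriple (Y, P.take k, Q.take k)).length)) := ⟨hA (Y, P.take k, Q.take k)⟩
  have h3 := hK []
    { s with
      y := Y.reverse, p := P, q := Q, cnt := List.replicate k true,
      aux := List.replicate k true } _ _ ht (by simpa [takeOr_none] using hM)
  simp only [List.length_replicate, List.length_reverse] at h3
  have h4 : Effect (count .acc .tmp .cnt : MProg M) (7 * n + 4) [] _
      (update (fun _ => []) M.k₁ ((A.V Y (P.take k) (Q.take k)).map e'.symm)) []
      { s with
        y := [], p := P.drop k, q := Q.drop k, cnt := List.replicate n true, aux := [] } _ :=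
    (count_effect (i := .acc) (t := .tmp) (j := .cnt)
      (s := { s with y := [], p := P.drop k, q := Q.drop k, cnt := [], aux := [] })
      (by decide) (by decide) (by decide) ht).congr (by simp [Data.get, hn])
      (by simp [Data.get, Data.set, hn]; rfl)
  have h5 := fetch_effect (M := M) (I := [])
    (s := { s with
      y := [], p := P.drop k, q := Q.drop k, cnt := List.replicate n true, aux := [] }) e' (k := .cnt) (j := .y) (by decide)
    (A.V Y (P.take k) (Q.take k))
  refine (h1.seq (h2.seq (h3.seq (h4.seq h5)))).congr ?_ ?_
  · have hlen : (encTriple (Y, P.take k, Q.take k)).length ≤ n + 2 * A.ℓ.eval n + 2 := by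
      have := eval_mono_nat A.ℓ hY
      rw [length_encTriple]
      simp only [List.length_take]
      omega
    have hout := hK' _ _ _ hM
    have htime := eval_mono_nat time hlen
    have g1 := eval_mono_nat A.ℓ hY
    have g2 := eval_mono_nat R hY
    have g3 := Nat.mul_le_mul_left K htime
    have g4 := Nat.mul_le_mul_left K' htime
    simp only [List.length_map] at hout
    simp only [eval_add, eval_mul, eval_comp, eval_C, eval_X, eval_ofNat, Data.get,
      List.length_replicate]
    omega
  · simp [Data.set, Data.get, verifyStep, ← hk, ha, hc]

theorem each_round_effect {A : FS2PAlgorithm} {p : MProg M} {G n : ℕ}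
    (hp : ∀ (c : List Bool × List Bool × List Bool) (s : Data), c.1.length ≤ n →
        s.acc = List.replicate n true → s.tmp = [] → s.aux = [] → s.cnt = [] →
        Effect p G [] { s with y := c.1.reverse, p := c.2.1, q := c.2.2 } (fun _ => []) []
          { s with
            y := (verifyStep A.V A.ℓ.eval n c).1.reverse
            p := (verifyStep A.V A.ℓ.eval n c).2.1
            q := (verifyStep A.V A.ℓ.eval n c).2.2 } fun _ => [])
    (k : ℕ) (c : List Bool × List Bool × List Bool) (s : Data) (hc : c.1.length ≤ n)
    (hs : s.acc = List.replicate n true) (ht : s.tmp = []) (ha : s.aux = []) (hcnt : s.cnt = [])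
    (hf : s.fuel = List.replicate k true) :
    Effect (each .fuel p) (k * (G + 2) + 2) []
      { s with y := c.1.reverse, p := c.2.1, q := c.2.2 } (fun _ => []) []
      { s with
        y := ((verifyStep A.V A.ℓ.eval n)^[k] c).1.reverse
        p := ((verifyStep A.V A.ℓ.eval n)^[k] c).2.1
        q := ((verifyStep A.V A.ℓ.eval n)^[k] c).2.2
        fuel := [] } fun _ => [] := by
  induction k generalizing c s with
  | zero =>
    refine (sub_forPop_nil (show stk (M := M) []
      { s with y := c.1.reverse, p := c.2.1, q := c.2.2 } (fun _ => []) (work .fuel) = [] from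
        hf)).congr ?_ ?_
    · simp
    congr 1
    ext1 <;> simp [hf]
  | succ k ih =>
    have h1 := ih (verifyStep A.V A.ℓ.eval n c) { s with fuel := List.replicate k true }
      (by simp [verifyStep]) hs ht ha hcnt rfl
    refine (sub_forPop_cons (a := true) (l := List.replicate k true) (r' := none) hf ?_ h1).congr
      (s := G + (k * (G + 2) + 2) + 2) ?_ rfl
    · rw [update_stk_work]
      exact hp c { s with fuel := List.replicate k true } hc hs ht ha hcnt _
    · rw [Nat.add_mul k 1]
      omega

end MProg

end SymAlt

namespace SymAlt

open Turing Function

namespace MProg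

open Prog

variable {M : FinTM2}

/-- The bit computed by the verifier for the language of a constructor: `w` is the first iterate of
the constructor. -/
def verify (A : FS2PAlgorithm) (w : List Bool) (x π₁ π₂ : List Bool) : Bool :=
  ((verifyStep A.V A.ℓ.eval (binVal 1 x))^[binVal 1 x - 1]
    (w.take (binVal 1 x), π₁, π₂)).1.reverse.headD false

/-- The verifier for the language of a constructor, where `p` executes one step. -/
def verifier (p : MProg M) (w : List Bool) : MProg M :=
  readInput .y ;; shift .y .x ;; put .acc true ;; evalBinary ;; count .acc .tmp .fuel ;;
    drop .fuel ;; putList .x w ;; count .acc .tmp .cnt ;; takeWork .cnt .x .y none ;; erase .x ;;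
    each .fuel p ;; outputTop ;; erase .y ;; erase .p ;; erase .q ;; erase .acc

/-- Bounds what remains on the stacks after the rounds, and so the cost of erasing it. -/
theorem length_verifyStep_iterate_le {V : List Bool → List Bool → List Bool → List Bool}
    {ℓ : ℕ → ℕ} {n : ℕ} (k : ℕ) (c : List Bool × List Bool × List Bool) :
    (c.1.length ≤ n → ((verifyStep V ℓ n)^[k] c).1.length ≤ n) ∧
    ((verifyStep V ℓ n)^[k] c).2.1.length ≤ c.2.1.length ∧
    ((verifyStep V ℓ n)^[k] c).2.2.length ≤ c.2.2.length := by
  induction k with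
  | zero => simp
  | succ k ih =>
    rw [iterate_succ_apply']
    refine ⟨fun _ => by simp [verifyStep], ?_, ?_⟩
    · simp only [verifyStep, List.length_drop]
      omega
    · simp only [verifyStep, List.length_drop]
      omega

open Polynomial in
-- `binVal 1 x` is the index of `x` plus one, the number of bits needed. It is at most `2 ^ (|x| +
-- 1)`, so unary counters of this length are affordable. The first iterate `w` is wired into the
-- program, which leaves one round fewer; hence the symbol dropped from `fuel`.
theorem exists_verifier_effect (A : FS2PAlgorithm) (w : List Bool) :
    ∃ (M : FinTM2) (p : MProg M) (Q : ℕ[X]), ∀ x π₁ π₂ : List Bool,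
      Effect p (40 * (x.length + π₁.length + π₂.length) + Q.eval (2 ^ (x.length + 1)))
        (encTriple (x, π₁, π₂)) {} (fun _ => []) [] { out := [verify A w x π₁ π₂] }
        fun _ => [] := by
  obtain ⟨M, p, G, hp⟩ := exists_round_effect A
  refine ⟨M, verifier p w, X * (12 * X + 9) + 40 * X + C (5 * w.length) + X * (G + 2) + 100,
    fun x π₁ π₂ => ?_⟩
  set n := binVal 1 x with hn
  have hn1 : 1 ≤ n := le_binVal 1 x
  have hnB : n ≤ 2 ^ (x.length + 1) := by
    have := binVal_lt 1 x
    rw [pow_succ]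
    omega
  have hxB : x.length ≤ 2 ^ (x.length + 1) :=
    (Nat.le_succ _).trans (Nat.lt_two_pow_self (n := x.length + 1)).le
  have h1 := readInput_effect (M := M) (S := fun _ => []) (j := .y) (Or.inr rfl) x π₁ π₂
  have h2 : Effect (shift .y .x : MProg M) (3 * x.length + 2) [] _ (fun _ => []) []
      { p := π₁, q := π₂, x := x } fun _ => [] :=
    (shift_effect (i := .y) (j := .x) (s := { p := π₁, q := π₂, y := x.reverse })
      (by decide)).congr (by simp [Data.get]) (by simp [Data.get, Data.set])
  have h3 : Effect (put .acc true : MProg M) 2 [] _ (fun _ => []) []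
      { p := π₁, q := π₂, x := x, acc := List.replicate 1 true } fun _ => [] :=
    put_effect (s := { p := π₁, q := π₂, x := x }) .acc true
  have h4 := evalBinary_effect (M := M) (I := []) (S := fun _ => [])
    (s := { p := π₁, q := π₂, x := x, acc := List.replicate 1 true }) hnB rfl rfl rfl
  rw [← hn] at h4
  have h5 : Effect (count .acc .tmp .fuel : MProg M) (7 * n + 4) [] _ (fun _ => []) []
      { p := π₁, q := π₂, acc := List.replicate n true, fuel := List.replicate n true }
      fun _ => [] :=
    (count_effect (i := .acc) (t := .tmp) (j := .fuel)
      (s := { p := π₁, q := π₂, acc := List.replicate n true }) (by decide) (by decide) (by decide)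
      rfl).congr (by simp [Data.get]) (by simp [Data.get, Data.set])
  have h6 : Effect (drop .fuel : MProg M) 2 [] _ (fun _ => []) []
      { p := π₁, q := π₂, acc := List.replicate n true, fuel := List.replicate (n - 1) true }
      fun _ => [] :=
    (drop_effect (s := { p := π₁, q := π₂, acc := List.replicate n true,
                         fuel := List.replicate n true }) .fuel).congr le_rfl
      (by simp [Data.get, Data.set])
  have h7 : Effect (putList .x w : MProg M) (2 * w.length + 1) [] _ (fun _ => []) []
      { p := π₁, q := π₂, acc := List.replicate n true, fuel := List.replicate (n - 1) true,
        x := w } fun _ => [] :=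
    (putList_effect (s := { p := π₁, q := π₂, acc := List.replicate n true,
                            fuel := List.replicate (n - 1) true }) .x w).congr le_rfl
      (by simp [Data.get, Data.set])
  have h8 : Effect (count .acc .tmp .cnt : MProg M) (7 * n + 4) [] _ (fun _ => []) []
      { p := π₁, q := π₂, acc := List.replicate n true, fuel := List.replicate (n - 1) true,
        x := w, cnt := List.replicate n true } fun _ => [] :=
    (count_effect (i := .acc) (t := .tmp) (j := .cnt)
      (s := { p := π₁, q := π₂, acc := List.replicate n true,
              fuel := List.replicate (n - 1) true, x := w }) (by decide) (by decide) (by decide)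
      rfl).congr (by simp [Data.get]) (by simp [Data.get, Data.set])
  have h9 : Effect (takeWork .cnt .x .y none : MProg M) (5 * n + 2) [] _ (fun _ => []) []
      { p := π₁, q := π₂, acc := List.replicate n true, fuel := List.replicate (n - 1) true,
        x := w.drop n, y := (w.take n).reverse } fun _ => [] :=
    (takeWork_effect (k := .cnt) (i := .x) (j := .y)
      (s := { p := π₁, q := π₂, acc := List.replicate n true,
              fuel := List.replicate (n - 1) true, x := w, cnt := List.replicate n true })
      (by decide) (by decide) (by decide) none).congr (by simp [Data.get])
      (by simp [Data.get, Data.set, takeOr_none])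
  have h10 : Effect (erase .x : MProg M) (3 * w.length + 2) [] _ (fun _ => []) []
      { p := π₁, q := π₂, acc := List.replicate n true, fuel := List.replicate (n - 1) true,
        y := (w.take n).reverse } fun _ => [] :=
    (erase_effect (s := { p := π₁, q := π₂, acc := List.replicate n true,
                          fuel := List.replicate (n - 1) true, x := w.drop n,
                          y := (w.take n).reverse }) .x).congr (by simp [Data.get])
      (by simp [Data.set])
  have h11 := each_round_effect (A := A) (p := p) (G := G.eval n) (hp n) (n - 1)
    (w.take n, π₁, π₂)
    { acc := List.replicate n true, fuel := List.replicate (n - 1) true } (by simp) rfl rfl rfl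
    rfl rfl
  obtain ⟨l1, l2, l3⟩ := length_verifyStep_iterate_le (V := A.V) (ℓ := A.ℓ.eval) (n := n) (n - 1)
    (w.take n, π₁, π₂)
  have hv : ((verifyStep A.V A.ℓ.eval n)^[n - 1] (w.take n, π₁, π₂)).1.reverse.headD false =
    verify A w x π₁ π₂ := rfl
  generalize (verifyStep A.V A.ℓ.eval n)^[n - 1] (w.take n, π₁, π₂) = c at *
  obtain ⟨Y, P, R⟩ := c
  simp only at h11 l1 l2 l3 hv
  have h12 := outputTop_effect (M := M) (I := []) (S := fun _ => [])
    (s := { acc := List.replicate n true, y := Y.reverse, p := P, q := R })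
  simp only [hv] at h12
  have h13 := erase_effect (M := M) (I := []) (S := fun _ => [])
    (s := { acc := List.replicate n true, y := Y.reverse.tail, p := P, q := R,
            out := [verify A w x π₁ π₂] }) .y
  have h14 := erase_effect (M := M) (I := []) (S := fun _ => [])
    (s := { acc := List.replicate n true, p := P, q := R, out := [verify A w x π₁ π₂] }) .p
  have h15 := erase_effect (M := M) (I := []) (S := fun _ => [])
    (s := { acc := List.replicate n true, q := R, out := [verify A w x π₁ π₂] }) .q
  have h16 := erase_effect (M := M) (I := []) (S := fun _ => [])
    (s := { acc := List.replicate n true, out := [verify A w x π₁ π₂] }) .acc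
  refine (h1.seq (h2.seq (h3.seq (h4.seq (h5.seq (h6.seq (h7.seq (h8.seq (h9.seq (h10.seq
    (h11.seq (h12.seq (h13.seq (h14.seq (h15.seq h16))))))))))))))).congr ?_ ?_
  · have g1 := eval_mono_nat G hnB
    have g2 : (n - 1) * (G.eval n + 2) ≤
        2 ^ (x.length + 1) * (G.eval (2 ^ (x.length + 1)) + 2) :=
      Nat.mul_le_mul (by omega) (by omega)
    have g3 : x.length * (12 * 2 ^ (x.length + 1) + 9) ≤
        2 ^ (x.length + 1) * (12 * 2 ^ (x.length + 1) + 9) := Nat.mul_le_mul_right _ hxB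
    have g4 := l1 (by simp)
    simp only [eval_add, eval_mul, eval_C, eval_X, eval_ofNat, Data.get, List.length_replicate,
      List.length_reverse, List.length_tail]
    clear h1 h2 h3 h4 h5 h6 h7 h8 h9 h10 h11 h12 h13 h14 h15 h16 hv hp
    clear_value n
    generalize 2 ^ (x.length + 1) = B at *
    generalize (n - 1) * (G.eval n + 2) = g at *
    generalize B * (G.eval B + 2) = g' at *
    generalize x.length * (12 * B + 9) = d at *
    generalize B * (12 * B + 9) = d' at *
    have g5 : Y.length - 1 ≤ n := (Nat.sub_le _ _).trans g4
    linarith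
  · simp [Data.set]

/-- The honest prover, who gives the first proof. -/
theorem exists_honest {V : List Bool → List Bool → List Bool → List Bool} {ℓ : ℕ → ℕ}
    {δ : List Bool → List Bool} (hℓ : Monotone ℓ)
    (hV : ∀ y, ∃ π₁ : List Bool, π₁.length = ℓ y.length ∧
      ∀ π₂ : List Bool, π₂.length = ℓ y.length → V y π₁ π₂ = δ y)
    (n k T : ℕ) (hT : k * ℓ n ≤ T) (y : List Bool) (hy : y.length ≤ n) :
    ∃ π₁ : List Bool, π₁.length = T ∧ ∀ π₂ : List Bool, π₂.length = T →
      ((verifyStep V ℓ n)^[k] (y, π₁, π₂)).1 = (fun y => (δ y).take n)^[k] y := by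
  induction k generalizing y T with
  | zero => exact ⟨List.replicate T false, by simp, fun _ _ => rfl⟩
  | succ k ih =>
    obtain ⟨π, hπ, h⟩ := hV y
    have hle : ℓ y.length ≤ ℓ n := hℓ hy
    rw [Nat.add_mul, Nat.one_mul] at hT
    -- A winning proof of this round is followed by one for the remaining rounds. The latter can be
    -- chosen in advance: the opponent's slice cannot change the value `δ y`, so the next string is
    -- `(δ y).take n` in any case.
    obtain ⟨π', hπ', h'⟩ := ih (T - ℓ y.length) (by omega) ((δ y).take n) (by simp)
    refine ⟨π ++ π', by rw [List.length_append]; omega, fun π₂ hπ₂ => ?_⟩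
    rw [iterate_succ_apply, iterate_succ_apply, ← h' (π₂.drop (ℓ y.length))
      (by rw [List.length_drop, hπ₂])]
    have h2 := h (π₂.take (ℓ y.length)) (by rw [List.length_take]; omega)
    simp only [verifyStep, ← hπ, List.take_left, List.drop_left]
    rw [hπ, h2]

theorem verifyStep_swap (V : List Bool → List Bool → List Bool → List Bool) (ℓ : ℕ → ℕ) (n k : ℕ)
    (y π₁ π₂ : List Bool) :
    ((verifyStep V ℓ n)^[k] (y, π₁, π₂)).1 =
      ((verifyStep (fun y π₁ π₂ => V y π₂ π₁) ℓ n)^[k] (y, π₂, π₁)).1 := by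
  induction k generalizing y π₁ π₂ with
  | zero => rfl
  | succ k ih =>
    rw [iterate_succ_apply, iterate_succ_apply]
    exact ih _ _ _

end MProg

/-! ### Truncated iteration, and the inclusion of the result class in `S2E` -/

theorem IsConstructor.iterate_take {δ : List Bool → List Bool} (hδ : IsConstructor δ) (n k : ℕ) :
    (fun y => (δ y).take n)^[k] ((δ []).take n) = (δ^[k + 1] []).take n := by
  induction k with
  | zero => rfl
  | succ k ih =>
    rw [iterate_succ_apply', ih, iterate_succ_apply' δ (k + 1)]
    generalize δ^[k + 1] [] = y
    -- If `y` has at most `n` bits, then nothing is cut off. Otherwise `y.take n` has length `n` and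
    -- is a prefix of its image, so the truncated step fixes it; and it consists of the first `n`
    -- bits of `δ y`, because `y` is a prefix of `δ y`.
    rcases le_or_gt y.length n with h | h
    · rw [List.take_of_length_le h]
    · have h1 := List.prefix_iff_eq_take.1 (hδ (y.take n)).1
      have h2 := (hδ y).1.take n
      rw [List.length_take, min_eq_left h.le] at h1
      rw [← h1]
      exact h2.eq_of_length (by
        have := (hδ y).1.length_le
        simp only [List.length_take]
        omega)

/-- A constructor gains at least one bit per application, so `δ^[N + 1] []` cut to `N + 1` bits has
exactly this length, and its last bit is bit `N` of the result. -/
theorem MProg.verify_eq {A : FS2PAlgorithm} {δ : List Bool → List Bool} {R : ℕ → Bool}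
    (hδ : IsConstructor δ) (hR : IsResult δ R) {N : ℕ} {π₁ π₂ : List Bool}
    (h : ((verifyStep A.V A.ℓ.eval (N + 1))^[N] ((δ []).take (N + 1), π₁, π₂)).1 =
      (fun y => (δ y).take (N + 1))^[N] ((δ []).take (N + 1))) :
    verify A (δ []) (stdEnum N) π₁ π₂ = R N := by
  have hl := hδ.le_length_iterate (N + 1)
  have hlen : ((δ^[N + 1] []).take (N + 1)).length = N + 1 := by
    rw [List.length_take]
    omega
  rw [verify, binVal_stdEnum, Nat.add_sub_cancel, h, hδ.iterate_take, hR (N + 1) N hl,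
    List.headD_eq_head?_getD, List.head?_reverse, List.getLast?_eq_getElem?, hlen,
    Nat.add_sub_cancel, List.getElem?_take_of_lt (Nat.lt_succ_self N), List.getElem?_eq_getElem hl,
    Option.getD_some]

open Polynomial in
theorem mem_charSeq_image {R : ℕ → Bool} (h : R ∈ resultClass FS2P) : R ∈ charSeq '' S2E := by
  obtain ⟨δ, ⟨A, hA⟩, hδ, hR⟩ := h
  obtain ⟨M, p, Q, hp⟩ := MProg.exists_verifier_effect A (δ [])
  obtain ⟨k₁, hk₁⟩ := exists_eval_two_pow_le (X * A.ℓ)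
  obtain ⟨k₂, hk₂⟩ := exists_eval_two_pow_le Q
  let L : Language Bool := {w | ∃ n, stdEnum n = w ∧ R n = true}
  have hL : ∀ N, chi L (stdEnum N) = R N := by
    intro N
    have : stdEnum N ∈ L ↔ R N = true := by
      constructor
      · rintro ⟨n, hn, h⟩
        rwa [← stdEnum_bijective.1 hn]
      · exact fun h => ⟨N, rfl, h⟩
    unfold chi
    by_cases h : R N = true
    · simp [this, h]
    · simp [this, h]
  refine ⟨L, ?_, funext hL⟩
  simp only [S2E, Set.mem_iUnion]
  -- `k₁` makes room for the proofs of all rounds, `k₂` accounts for the running time, and `1`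
  -- ensures `c ≥ 1`.
  set c := k₁ + k₂ + 1 with hc
  refine ⟨c, by simp [hc], MProg.verify A (δ []), ⟨p.toAux, fun m =>
    40 * (m + 2 ^ (c * m) + 2 ^ (c * m)) + Q.eval (2 ^ (m + 1)) + 1, ?_, ?_⟩, ?_⟩
  · refine Asymptotics.IsBigO.of_bound 122 (Filter.eventually_atTop.2 ⟨1, fun m hm => ?_⟩)
    simp only [Real.norm_natCast]
    have h1 : Q.eval (2 ^ (m + 1)) ≤ 2 ^ (c * m) := (hk₂ m hm).trans
      (Nat.pow_le_pow_right (by norm_num) (Nat.mul_le_mul_right m (by omega)))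
    have h2 : m ≤ 2 ^ (c * m) := (Nat.lt_two_pow_self (n := m)).le.trans
      (Nat.pow_le_pow_right (by norm_num) (Nat.le_mul_of_pos_left m (by omega)))
    have h3 : 1 ≤ 2 ^ (c * m) := Nat.one_le_two_pow
    have h4 : 40 * (m + 2 ^ (c * m) + 2 ^ (c * m)) + Q.eval (2 ^ (m + 1)) + 1 ≤
      122 * 2 ^ (c * m) := by omega
    exact_mod_cast h4
  · intro x π₁ π₂ h₁ h₂
    refine MProg.toAux_outputsInTime (hp x π₁ π₂) ?_
    rw [h₁, h₂]
    exact Nat.lt_succ_self _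
  · intro x
    obtain ⟨N, rfl⟩ := stdEnum_bijective.2 x
    have hT : N * A.ℓ.eval (N + 1) ≤ 2 ^ (c * (stdEnum N).length) := by
      -- For the empty string the proof length is `1` for every `c`, which may be too short for even
      -- one round. As `δ []` is wired in, no round is needed there.
      rcases Nat.eq_zero_or_pos (stdEnum N).length with h0 | h0
      · have hN : N = 0 := stdEnum_bijective.1 (by rw [List.length_eq_zero_iff.1 h0]; rfl)
        simp [hN]
      · have h1 := binVal_lt 1 (stdEnum N)
        rw [binVal_stdEnum] at h1
        have h2 : N + 1 ≤ 2 ^ ((stdEnum N).length + 1) := by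
          rw [pow_succ]
          omega
        calc N * A.ℓ.eval (N + 1) ≤ (X * A.ℓ).eval (2 ^ ((stdEnum N).length + 1)) := by
              rw [eval_mul, eval_X]
              exact Nat.mul_le_mul (by omega) (eval_mono_nat _ h2)
          _ ≤ 2 ^ (k₁ * (stdEnum N).length) := hk₁ _ h0
          _ ≤ _ := Nat.pow_le_pow_right (by norm_num) (Nat.mul_le_mul_right _ (by omega))
    rw [hL]
    constructor
    · obtain ⟨π₁, hπ₁, h⟩ := MProg.exists_honest (V := A.V) (ℓ := A.ℓ.eval) (δ := δ)
        (fun _ _ h => eval_mono_nat _ h) (fun y => (hA y).1) (N + 1) N _ hT ((δ []).take (N + 1))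
        (by simp)
      exact ⟨π₁, hπ₁, fun π₂ hπ₂ => MProg.verify_eq hδ hR (h π₂ hπ₂)⟩
    · obtain ⟨π₂, hπ₂, h⟩ := MProg.exists_honest (V := fun y π₁ π₂ => A.V y π₂ π₁)
        (ℓ := A.ℓ.eval) (δ := δ) (fun _ _ h => eval_mono_nat _ h) (fun y => (hA y).2) (N + 1) N _
        hT ((δ []).take (N + 1)) (by simp)
      refine ⟨π₂, hπ₂, fun π₁ hπ₁ => MProg.verify_eq hδ hR ?_⟩
      rw [MProg.verifyStep_swap]
      exact h π₁ hπ₁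

end SymAlt

theorem mainTheorem4 :
    SymAlt.resultClass SymAlt.FS2P = SymAlt.charSeq '' SymAlt.S2E := by
  ext R
  constructor
  · exact SymAlt.mem_charSeq_image
  · rintro ⟨L, hL, rfl⟩
    exact SymAlt.charSeq_mem_resultClass hL
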